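/- For a non-negative integer $n$ let $V_n=\{(i,j)\in\mathbb Z^2 : |i|+|j|\le n,\ j\le 0,\ i+j\equiv n \pmod 2\}$, a triangular array with corners $(-n,0)$, $(n,0)$, $(0,-n)$ (first coordinate drawn to the right, second upwards), and regard two points of $V_n$ as neighbours in the triangular lattice if their difference is one of $(\pm 2,0)$, $(\pm1,\pm1)$. A (simplified) grove of size $n$ is an acyclic graph $G$ with vertex set $V_n$, all of whose edges join neighbouring points, such that every connected component of $G$ contains exactly one of the following sets and each of these sets is contained in some component: - the corners $\{(-n,0)\}$, $\{(n,0)\}$, $\{(0,-n)\}$; - $\{(-i,0),(\frac{-n-i}{2},\frac{-n+i}{2})\}$ and $\{(i,0),(\frac{n+i}{2},\frac{-n+i}{2})\}$ for integers $0<i<n$, $i\equiv n \pmod 2$; - $\{(-n+i,-i),(n-i,-i)\}$ for integers $\frac n2<i<n$; - $\{(0,0),(-\frac n2,-\frac n2),(\frac n2,-\frac n2)\}$ if $n$ is even. The target graph $T_n$ on $V_n$ has exactly the following edges: for each integer $0\le k\le n$, those edges with both endpoints in $V_n$ of the lattice path that starts at $(-n+2k,0)$, descends by steps $(1,-1)$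 to $(-n+3k,-k)$, and then runs along the row $j=-k$ by steps $(-2,0)$. A clockwise spin replaces an edge $pq$ of a grove by the edge $pr$, where $r\in V_n$ is the neighbour of $p$ obtained by rotating $q$ about $p$ by one step ($60^\circ$ in the triangular lattice) clockwise, and $pr$ was not already an edge, such that the resulting graph is again a grove. That is, the direction of the rotated edge moves one step along the cyclic order $(-1,1)\to(1,1)\to(2,0)\to(1,-1)\to(-1,-1)\to(-2,0)\to(-1,1)$. **Theorem.** For every $n$, the graph $T_n$ is a grove of size $n$ (the target grove), and from every grove $G$ of size $n$ one can obtain $T_n$ by a finite (possibly empty) sequence of clockwise spins. -/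

import Mathlib

namespace Groves

/-- The vertices of a grove of size `n`: the lattice points `(i, j)` with `i + j ≡ n (mod 2)` in the
triangle with corners `(-n, 0)`, `(n, 0)`, `(0, -n)`. -/
abbrev Vertex (n : ℕ) : Type :=
  {p : ℤ × ℤ // |p.1| + |p.2| ≤ n ∧ p.2 ≤ 0 ∧ p.1 + p.2 ≡ n [ZMOD 2]}

/-- The six unit steps of the triangular lattice in clockwise order
(first coordinate to the right, second coordinate upwards):
north-west, north-east, east, south-east, south-west, west. -/
def dir : Fin 6 → ℤ × ℤ :=
  ![(-1, 1), (1, 1), (2, 0), (1, -1), (-1, -1), (-2, 0)]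

/-- The ambient triangular lattice graph: vertices are adjacent when they differ by a unit step. -/
def lattice (n : ℕ) : SimpleGraph (Vertex n) :=
  SimpleGraph.fromRel fun u v => ∃ d : Fin 6, v.1 = u.1 + dir d

/-- The blocks of the prescribed partition of the boundary vertices. All divisions are exact. -/
inductive IsBlock (n : ℕ) : Set (ℤ × ℤ) → Prop
  | cornerWest : IsBlock n {(-(n : ℤ), 0)}
  | cornerEast : IsBlock n {((n : ℤ), 0)}
  | cornerSouth : IsBlock n {(0, -(n : ℤ))}
  | westPair (i : ℤ) (h0 : 0 < i) (hn : i < n) (hp : i ≡ n [ZMOD 2]) :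
      IsBlock n {(-i, 0), ((-n - i) / 2, (-n + i) / 2)}
  | eastPair (i : ℤ) (h0 : 0 < i) (hn : i < n) (hp : i ≡ n [ZMOD 2]) :
      IsBlock n {(i, 0), ((n + i) / 2, (-n + i) / 2)}
  | southPair (i : ℤ) (h0 : n < 2 * i) (hn : i < n) :
      IsBlock n {(-n + i, -i), (n - i, -i)}
  | middleTriplet (he : Even n) :
      IsBlock n {(0, 0), (-(n : ℤ) / 2, -(n : ℤ) / 2), ((n : ℤ) / 2, -(n : ℤ) / 2)}

/-- (Simplified) groves of size `n`. -/
structure IsGrove (n : ℕ) (G : SimpleGraph (Vertex n)) : Prop where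
  /-- the edges are edges of the triangular lattice -/
  le_lattice : G ≤ lattice n
  acyclic : G.IsAcyclic
  /-- every component contains exactly one block -/
  existsUnique_block : ∀ c : G.ConnectedComponent,
    ∃! S : Set (ℤ × ℤ), IsBlock n S ∧ S ⊆ Subtype.val '' c.supp
  /-- every block is contained in some component -/
  block_subset : ∀ S : Set (ℤ × ℤ), IsBlock n S →
    ∃ c : G.ConnectedComponent, S ⊆ Subtype.val '' c.supp

/-- The target grove of size `n`. For each `k` it contains the part inside the triangle of the path
that starts at the top vertex `(-n + 2k, 0)`, runs in direction south-east down to the vertex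
`(-n + 3k, -k)`, and then runs west along the row `-k`. (For `2k > n` this path leaves the triangle
before it turns, and its two parts inside the triangle are disjoint.) -/
def target (n : ℕ) : SimpleGraph (Vertex n) :=
  SimpleGraph.fromRel fun u v => ∃ k : ℤ,
    (u.1.1 + u.1.2 = -n + 2 * k ∧ v.1 = u.1 + (1, -1) ∧ -k ≤ v.1.2) ∨
    (u.1.2 = -k ∧ v.1 = u.1 + (2, 0) ∧ v.1.1 ≤ -n + 3 * k)

/-- `H` arises from `G` by one clockwise spin: for some vertex `p` (the pivot), an edge `pq` of `G`
is rotated clockwise about `p` by one step (60 degrees) to the edge `pr`; nothing else changes. -/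
def ClockwiseSpin {n : ℕ} (G H : SimpleGraph (Vertex n)) : Prop :=
  ∃ (p q r : Vertex n) (d : Fin 6), q.1 = p.1 + dir d ∧ r.1 = p.1 + dir (d + 1) ∧
    G.Adj p q ∧ ¬ G.Adj p r ∧ H.edgeSet = insert s(p, r) (G.edgeSet \ {s(p, q)})

/-- A clockwise spin from a grove to a grove. -/
def GroveStep (n : ℕ) (G H : SimpleGraph (Vertex n)) : Prop :=
  IsGrove n G ∧ IsGrove n H ∧ ClockwiseSpin G H

end Groves

namespace Groves

open SimpleGraph

/-! ### Acyclic graphs, reachability and edge swaps. -/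

section Graph

variable {V : Type*} {G G' : SimpleGraph V}

/-! Clockwise spins are first traded for the moves of `Move`: rotating an edge inside a unit
triangle two of whose edges are present, and redirecting the only edge at an interior leaf. Both are
realised by clockwise spins through groves: in a triangle, two clockwise rotations have the effect
of one counterclockwise rotation, and a leaf edge can be turned clockwise until it reaches the
desired direction (`groveStep_of_move`). It therefore suffices that any two groves of the same size
are connected by moves (`moves_of_isGrove`) and that the target is a grove (`isGrove_target`).

Connectedness is proved by induction from size `m` to size `m + 2`. The vertices `o` of the small
triangle index the upward unit triangles of the large one; conversely, the small vertices incident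
with a large vertex `p` lie in one downward unit triangle. A lattice edge in none of these upward
triangles joins boundary vertices of different blocks, so a grove never uses it. Hence a large grove
amounts to a bipartite relation `H` contained in `Inc` together with a centre for each `o`: the
points related to `o` form a star. Reading the same `H` from the other side, with a star at each
`p`, gives a graph on the small triangle. Both graphs inherit connectivity and acyclicity from the
bipartite graph `H`, so the lower graph is again a grove (`IsGrove.exists_lower`).

Upper centres can be changed by moves (`moves_recenter`), and relations with the same lower graph
are connected by moves (`movesTo_of_lower_eq`). What remains is to lift one move of the small grove
(`LowerValid.lift`). A leaf move becomes, after normalising `H`, a change of `H` that the upper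
graph does not see. A triangle move is either a mere change of lower centre, or one or two exchanges
of incidences in a hexagon of three large and three small vertices, each exchange being a triangle
move upstairs (`movesTo_hexagon`). -/

theorem reachable_map {W : Type*} {K : SimpleGraph W} {f : V → W}
    (h : ∀ u v, G.Adj u v → K.Reachable (f u) (f v)) {u v : V} (huv : G.Reachable u v) :
    K.Reachable (f u) (f v) := by
  obtain ⟨w⟩ := huv
  induction w with
  | nil => exact .refl _
  | cons hadj _ ih => exact (h _ _ hadj).trans ih

theorem reachable_of_adj (h : ∀ u v, G.Adj u v → G'.Reachable u v) {u v : V}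
    (huv : G.Reachable u v) : G'.Reachable u v :=
  reachable_map (f := id) h huv

theorem of_reachable {φ : V → Prop} (h : ∀ u v, φ u → G.Adj u v → φ v) {u v : V}
    (huv : G.Reachable u v) (hu : φ u) : φ v := by
  obtain ⟨w⟩ := huv
  induction w with
  | nil => exact hu
  | cons hadj _ ih => exact ih (h _ _ hu hadj)

theorem exists_adj_of_reachable {u v : V} (huv : G.Reachable u v) (hne : u ≠ v) :
    ∃ w, G.Adj u w := by
  obtain ⟨w⟩ := huv
  cases w with
  | nil => exact absurd rfl hne
  | cons hadj _ => exact ⟨_, hadj⟩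

theorem not_reachable_deleteEdges (hG : G.IsAcyclic) {u v : V} (h : G.Adj u v) :
    ¬ (G.deleteEdges {s(u, v)}).Reachable u v := by
  have := isAcyclic_iff_forall_adj_isBridge.1 hG h
  rw [isBridge_iff] at this
  simpa using this

theorem isAcyclic_of_forall (h : ∀ u v, G.Adj u v → ¬ (G.deleteEdges {s(u, v)}).Reachable u v) :
    G.IsAcyclic := by
  rw [isAcyclic_iff_forall_adj_isBridge]
  intro u v huv
  rw [isBridge_iff]
  simpa using h u v huv

theorem deleteEdges_pair_adj {a b u v : V} : (G.deleteEdges {s(a, b)}).Adj u v ↔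
    G.Adj u v ∧ ¬ ((u = a ∧ v = b) ∨ (u = b ∧ v = a)) := by
  simp

theorem not_triangle (hG : G.IsAcyclic) {x y z : V} (hxy : G.Adj x y) (hyz : G.Adj y z)
    (hxz : G.Adj x z) : False := by
  refine not_reachable_deleteEdges hG hxz ?_
  have h1 : (G.deleteEdges {s(x, z)}).Adj x y := by
    rw [deleteEdges_pair_adj]
    refine ⟨hxy, ?_⟩
    rintro (⟨-, h⟩ | ⟨h, -⟩)
    · exact hyz.ne h
    · exact hxz.ne h
  have h2 : (G.deleteEdges {s(x, z)}).Adj y z := by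
    rw [deleteEdges_pair_adj]
    refine ⟨hyz, ?_⟩
    rintro (⟨h, -⟩ | ⟨-, h⟩)
    · exact hxy.ne h.symm
    · exact hxz.ne h.symm
  exact h1.reachable.trans h2.reachable

theorem not_square (hG : G.IsAcyclic) {x y z w : V} (hxy : G.Adj x y) (hyw : G.Adj y w)
    (hwz : G.Adj w z) (hxz : G.Adj x z) (hyz : y ≠ z) (hxw : x ≠ w) : False := by
  refine not_reachable_deleteEdges hG hxz ?_
  have h1 : (G.deleteEdges {s(x, z)}).Adj x y := by
    rw [deleteEdges_pair_adj]
    refine ⟨hxy, ?_⟩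
    rintro (⟨-, h⟩ | ⟨h, -⟩)
    · exact hyz h
    · exact hxz.ne h
  have h2 : (G.deleteEdges {s(x, z)}).Adj y w := by
    rw [deleteEdges_pair_adj]
    refine ⟨hyw, ?_⟩
    rintro (⟨h, -⟩ | ⟨h, -⟩)
    · exact hxy.ne h.symm
    · exact hyz h
  have h3 : (G.deleteEdges {s(x, z)}).Adj w z := by
    rw [deleteEdges_pair_adj]
    refine ⟨hwz, ?_⟩
    rintro (⟨h, -⟩ | ⟨h, -⟩)
    · exact hxw h.symm
    · exact hwz.ne h
  exact (h1.reachable.trans h2.reachable).trans h3.reachable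

/-- The graph obtained from `G` by replacing the edge `e` with the edge `f`. -/
def swap (G : SimpleGraph V) (e f : Sym2 V) : SimpleGraph V :=
  fromEdgeSet (insert f (G.edgeSet \ {e}))

theorem swap_adj {a b c d u v : V} : (swap G s(a, b) s(c, d)).Adj u v ↔
    u ≠ v ∧ (((u = c ∧ v = d) ∨ (u = d ∧ v = c)) ∨
      (G.Adj u v ∧ ¬ ((u = a ∧ v = b) ∨ (u = b ∧ v = a)))) := by
  simp [swap]
  tauto

theorem swap_edgeSet {e : Sym2 V} {c d : V} (h : c ≠ d) :
    (swap G e s(c, d)).edgeSet = insert s(c, d) (G.edgeSet \ {e}) := by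
  rw [swap, edgeSet_fromEdgeSet]
  ext x
  induction x with | h u v =>
  simp only [Set.mem_sdiff, Set.mem_insert_iff, Sym2.mem_diagSet, Sym2.mk_isDiag_iff]
  constructor
  · tauto
  · intro hx
    refine ⟨hx, ?_⟩
    rcases hx with hx | ⟨hx, -⟩
    · rintro rfl
      simp only [Sym2.eq_iff] at hx
      grind
    · exact (G.mem_edgeSet.1 hx).ne

theorem isAcyclic_swap (hG : G.IsAcyclic) {a b c d : V}
    (h : ¬ (G.deleteEdges {s(a, b)}).Reachable c d) : (swap G s(a, b) s(c, d)).IsAcyclic := by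
  have h1 : (G.deleteEdges {s(a, b)}).IsAcyclic := hG.anti (deleteEdges_le _)
  have h2 := h1.sup_edge_of_not_reachable h
  convert h2
  ext u v
  rw [swap_adj, sup_adj, deleteEdges_pair_adj, edge_adj]
  have : G.Adj u v → u ≠ v := fun h => h.ne
  tauto

end Graph

/-! ### Coordinates, labels and blocks. -/

theorem mem_iff {n : ℕ} {x y : ℤ} : (|x| + |y| ≤ n ∧ y ≤ 0 ∧ x + y ≡ n [ZMOD 2]) ↔
    y ≤ 0 ∧ x - y ≤ n ∧ -x - y ≤ n ∧ (x + y - n) % 2 = 0 := by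
  unfold Int.ModEq
  rcases abs_cases x with h | h <;> rcases abs_cases y with h' | h' <;>
    constructor <;> intro _ <;> omega

theorem Vertex.bounds {n : ℕ} (v : Vertex n) : v.1.2 ≤ 0 ∧ v.1.1 - v.1.2 ≤ n ∧
    -v.1.1 - v.1.2 ≤ n ∧ (v.1.1 + v.1.2 - n) % 2 = 0 :=
  mem_iff.1 v.2

theorem exists_vertex {n : ℕ} {x y : ℤ} (h1 : y ≤ 0) (h2 : x - y ≤ n) (h3 : -x - y ≤ n)
    (h4 : (x + y - n) % 2 = 0) : ∃ v : Vertex n, v.1.1 = x ∧ v.1.2 = y :=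
  ⟨⟨(x, y), mem_iff.2 ⟨h1, h2, h3, h4⟩⟩, rfl, rfl⟩

theorem vertex_ext {n : ℕ} {u v : Vertex n} (h1 : u.1.1 = v.1.1) (h2 : u.1.2 = v.1.2) : u = v :=
  Subtype.ext (Prod.ext h1 h2)

/-- The vertices on the boundary of the triangle. -/
def Boundary {n : ℕ} (v : Vertex n) : Prop :=
  v.1.2 = 0 ∨ v.1.1 + v.1.2 = -n ∨ v.1.1 - v.1.2 = n

/-- A label, constant along the paths of the target grove, whose level sets on the boundary are
the blocks. -/
def label {n : ℕ} (v : Vertex n) : ℤ :=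
  if 0 < v.1.1 + v.1.2 then v.1.1 + v.1.2 + n
  else if (n : ℤ) < -2 * v.1.2 then 2 * v.1.2
  else if v.1.1 + v.1.2 + n ≤ -2 * v.1.2 then -2 * v.1.2 else v.1.1 + v.1.2 + n

/-- The boundary vertices with the same label as `b`. -/
def blockOf {n : ℕ} (b : Vertex n) : Set (ℤ × ℤ) :=
  Subtype.val '' {v : Vertex n | Boundary v ∧ label v = label b}

theorem mem_blockOf {n : ℕ} {b v : Vertex n} :
    v.1 ∈ blockOf b ↔ Boundary v ∧ label v = label b := by
  unfold blockOf
  rw [Subtype.val_injective.mem_set_image]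
  rfl

theorem eq_blockOf {n : ℕ} {S : Set (ℤ × ℤ)} {b : Vertex n}
    (h : ∀ v : Vertex n, v.1 ∈ S ↔ Boundary v ∧ label v = label b)
    (h' : ∀ p ∈ S, ∃ v : Vertex n, v.1.1 = p.1 ∧ v.1.2 = p.2) : S = blockOf b := by
  ext p
  constructor
  · intro hp
    obtain ⟨v, h1, h2⟩ := h' p hp
    have : p = v.1 := Prod.ext h1.symm h2.symm
    subst this
    rw [mem_blockOf]
    exact (h v).1 hp
  · rintro ⟨v, hv, rfl⟩
    exact (h v).2 hv

set_option maxHeartbeats 1600000 in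
theorem IsBlock.exists_eq_blockOf {n : ℕ} {S : Set (ℤ × ℤ)} (hS : IsBlock n S) :
    ∃ b : Vertex n, Boundary b ∧ S = blockOf b := by
  cases hS with
  | cornerWest =>
    obtain ⟨b, hx, hy⟩ := exists_vertex (n := n) (x := -n) (y := 0) (by omega) (by omega)
      (by omega) (by omega)
    refine ⟨b, by unfold Boundary; omega, eq_blockOf (fun v => ?_) ?_⟩
    · have := v.bounds
      simp only [Set.mem_singleton_iff, Prod.ext_iff, Boundary, label]
      rw [hx, hy]
      split_ifs <;> omega
    · rintro p rfl
      exact ⟨b, hx, hy⟩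
  | cornerEast =>
    obtain ⟨b, hx, hy⟩ := exists_vertex (n := n) (x := n) (y := 0) (by omega) (by omega)
      (by omega) (by omega)
    refine ⟨b, by unfold Boundary; omega, eq_blockOf (fun v => ?_) ?_⟩
    · have := v.bounds
      simp only [Set.mem_singleton_iff, Prod.ext_iff, Boundary, label]
      rw [hx, hy]
      split_ifs <;> omega
    · rintro p rfl
      exact ⟨b, hx, hy⟩
  | cornerSouth =>
    obtain ⟨b, hx, hy⟩ := exists_vertex (n := n) (x := 0) (y := -n) (by omega) (by omega)
      (by omega) (by omega)
    refine ⟨b, by unfold Boundary; omega, eq_blockOf (fun v => ?_) ?_⟩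
    · have := v.bounds
      simp only [Set.mem_singleton_iff, Prod.ext_iff, Boundary, label]
      rw [hx, hy]
      split_ifs <;> omega
    · rintro p rfl
      exact ⟨b, hx, hy⟩
  | westPair i h0 hn hp =>
    unfold Int.ModEq at hp
    obtain ⟨b, hx, hy⟩ := exists_vertex (n := n) (x := -i) (y := 0) (by omega) (by omega)
      (by omega) (by omega)
    obtain ⟨b', hx', hy'⟩ := exists_vertex (n := n) (x := (-n - i) / 2) (y := (-n + i) / 2)
      (by omega) (by omega) (by omega) (by omega)
    refine ⟨b, by unfold Boundary; omega, eq_blockOf (fun v => ?_) ?_⟩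
    · have := v.bounds
      simp only [Set.mem_singleton_iff, Set.mem_insert_iff, Prod.ext_iff, Boundary, label]
      rw [hx, hy]
      split_ifs <;> omega
    · rintro p (rfl | rfl)
      · exact ⟨b, hx, hy⟩
      · exact ⟨b', hx', hy'⟩
  | eastPair i h0 hn hp =>
    unfold Int.ModEq at hp
    obtain ⟨b, hx, hy⟩ := exists_vertex (n := n) (x := i) (y := 0) (by omega) (by omega)
      (by omega) (by omega)
    obtain ⟨b', hx', hy'⟩ := exists_vertex (n := n) (x := (n + i) / 2) (y := (-n + i) / 2)
      (by omega) (by omega) (by omega) (by omega)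
    refine ⟨b, by unfold Boundary; omega, eq_blockOf (fun v => ?_) ?_⟩
    · have := v.bounds
      simp only [Set.mem_singleton_iff, Set.mem_insert_iff, Prod.ext_iff, Boundary, label]
      rw [hx, hy]
      split_ifs <;> omega
    · rintro p (rfl | rfl)
      · exact ⟨b, hx, hy⟩
      · exact ⟨b', hx', hy'⟩
  | southPair i h0 hn =>
    obtain ⟨b, hx, hy⟩ := exists_vertex (n := n) (x := -n + i) (y := -i) (by omega) (by omega)
      (by omega) (by omega)
    obtain ⟨b', hx', hy'⟩ := exists_vertex (n := n) (x := n - i) (y := -i)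
      (by omega) (by omega) (by omega) (by omega)
    refine ⟨b, by unfold Boundary; omega, eq_blockOf (fun v => ?_) ?_⟩
    · have := v.bounds
      simp only [Set.mem_singleton_iff, Set.mem_insert_iff, Prod.ext_iff, Boundary, label]
      rw [hx, hy]
      split_ifs <;> omega
    · rintro p (rfl | rfl)
      · exact ⟨b, hx, hy⟩
      · exact ⟨b', hx', hy'⟩
  | middleTriplet he =>
    obtain ⟨k, hk⟩ := he
    obtain ⟨b, hx, hy⟩ := exists_vertex (n := n) (x := 0) (y := 0) (by omega) (by omega)
      (by omega) (by omega)
    obtain ⟨b', hx', hy'⟩ := exists_vertex (n := n) (x := -n / 2) (y := -n / 2)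
      (by omega) (by omega) (by omega) (by omega)
    obtain ⟨b2, hx2, hy2⟩ := exists_vertex (n := n) (x := n / 2) (y := -n / 2)
      (by omega) (by omega) (by omega) (by omega)
    refine ⟨b, by unfold Boundary; omega, eq_blockOf (fun v => ?_) ?_⟩
    · have := v.bounds
      simp only [Set.mem_singleton_iff, Set.mem_insert_iff, Prod.ext_iff, Boundary, label]
      rw [hx, hy]
      split_ifs <;> omega
    · rintro p (rfl | rfl | rfl)
      · exact ⟨b, hx, hy⟩
      · exact ⟨b', hx', hy'⟩
      · exact ⟨b2, hx2, hy2⟩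

/-- Every block is a full label class on the boundary, so it is enough to find some block through
`b`. -/
theorem isBlock_blockOf {n : ℕ} {b : Vertex n} (hb : Boundary b) : IsBlock n (blockOf b) := by
  suffices h : ∃ S, IsBlock n S ∧ b.1 ∈ S by
    obtain ⟨S, hS, hbS⟩ := h
    obtain ⟨b', hb', rfl⟩ := hS.exists_eq_blockOf
    convert hS using 1
    have := (mem_blockOf.1 hbS).2
    unfold blockOf
    rw [this]
  have h1 := b.bounds
  obtain ⟨⟨x, y⟩, hmem⟩ := b
  simp only [Boundary] at hb h1 ⊢
  rcases hb with rfl | hb | hb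
  · rcases lt_trichotomy x 0 with hx | rfl | hx
    · by_cases hn : x = -n
      · exact ⟨_, .cornerWest, by simp [hn]⟩
      · exact ⟨_, .westPair (-x) (by omega) (by omega) (by unfold Int.ModEq; omega), by simp⟩
    · exact ⟨_, .middleTriplet (by rw [Nat.even_iff]; omega), by simp⟩
    · by_cases hn : x = n
      · exact ⟨_, .cornerEast, by simp [hn]⟩
      · exact ⟨_, .eastPair x (by omega) (by omega) (by unfold Int.ModEq; omega), by simp⟩
  · by_cases hy0 : y = 0
    · exact ⟨_, .cornerWest, by simp only [Set.mem_singleton_iff, Prod.ext_iff]; omega⟩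
    by_cases hyn : y = -n
    · exact ⟨_, .cornerSouth, by simp only [Set.mem_singleton_iff, Prod.ext_iff]; omega⟩
    rcases lt_trichotomy (-2 * y) n with h | h | h
    · exact ⟨_, .westPair (n + 2 * y) (by omega) (by omega) (by unfold Int.ModEq; omega), by
        simp only [Set.mem_singleton_iff, Set.mem_insert_iff, Prod.ext_iff]; omega⟩
    · exact ⟨_, .middleTriplet (by rw [Nat.even_iff]; omega), by
        simp only [Set.mem_singleton_iff, Set.mem_insert_iff, Prod.ext_iff]; omega⟩
    · exact ⟨_, .southPair (-y) (by omega) (by omega), by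
        simp only [Set.mem_singleton_iff, Set.mem_insert_iff, Prod.ext_iff]; omega⟩
  · by_cases hy0 : y = 0
    · exact ⟨_, .cornerEast, by simp only [Set.mem_singleton_iff, Prod.ext_iff]; omega⟩
    by_cases hyn : y = -n
    · exact ⟨_, .cornerSouth, by simp only [Set.mem_singleton_iff, Prod.ext_iff]; omega⟩
    rcases lt_trichotomy (-2 * y) n with h | h | h
    · exact ⟨_, .eastPair (n + 2 * y) (by omega) (by omega) (by unfold Int.ModEq; omega), by
        simp only [Set.mem_singleton_iff, Set.mem_insert_iff, Prod.ext_iff]; omega⟩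
    · exact ⟨_, .middleTriplet (by rw [Nat.even_iff]; omega), by
        simp only [Set.mem_singleton_iff, Set.mem_insert_iff, Prod.ext_iff]; omega⟩
    · exact ⟨_, .southPair (-y) (by omega) (by omega), by
        simp only [Set.mem_singleton_iff, Set.mem_insert_iff, Prod.ext_iff]; omega⟩

/-- Since the blocks are the label classes, the two conditions on components say that each component
meets the boundary and does so in exactly one label class. This form is the working definition of a
grove from here on. -/
theorem isGrove_iff {n : ℕ} {G : SimpleGraph (Vertex n)} : IsGrove n G ↔
    G ≤ lattice n ∧ G.IsAcyclic ∧ (∀ v, ∃ b, Boundary b ∧ G.Reachable v b) ∧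
      ∀ b b', Boundary b → Boundary b' → (G.Reachable b b' ↔ label b = label b') := by
  have hsub : ∀ (b : Vertex n) (c : G.ConnectedComponent), blockOf b ⊆ Subtype.val '' c.supp ↔
      ∀ v, Boundary v → label v = label b → G.connectedComponentMk v = c := by
    intro b c
    unfold blockOf
    rw [Set.image_subset_image_iff Subtype.val_injective]
    exact ⟨fun h v h1 h2 => h ⟨h1, h2⟩, fun h v hv => h v hv.1 hv.2⟩
  constructor
  · intro hG
    refine ⟨hG.le_lattice, hG.acyclic, fun v => ?_, fun b b' hb hb' => ?_⟩
    · obtain ⟨S, ⟨hS, hSc⟩, -⟩ := hG.existsUnique_block (G.connectedComponentMk v)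
      obtain ⟨b, hb, rfl⟩ := hS.exists_eq_blockOf
      exact ⟨b, hb, (ConnectedComponent.eq.1 ((hsub _ _).1 hSc b hb rfl)).symm⟩
    · have key : ∀ b : Vertex n, Boundary b →
          blockOf b ⊆ Subtype.val '' (G.connectedComponentMk b).supp := by
        intro b hb
        obtain ⟨c, hc⟩ := hG.block_subset _ (isBlock_blockOf hb)
        rwa [(hsub _ _).1 hc b hb rfl]
      constructor
      · intro h
        have h1 := key b hb
        have h2 := key b' hb'
        rw [← ConnectedComponent.eq.2 h] at h2
        have h3 := (hG.existsUnique_block _).unique ⟨isBlock_blockOf hb, h1⟩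
          ⟨isBlock_blockOf hb', h2⟩
        have h4 : b.1 ∈ blockOf b' := h3 ▸ mem_blockOf.2 ⟨hb, rfl⟩
        exact (mem_blockOf.1 h4).2
      · intro h
        exact ConnectedComponent.eq.1 ((hsub _ _).1 (key b' hb') b hb h)
  · rintro ⟨hl, ha, hc, hbb⟩
    refine ⟨hl, ha, fun c => ?_, fun S hS => ?_⟩
    · induction c using ConnectedComponent.ind with | h v =>
      obtain ⟨b, hb, hvb⟩ := hc v
      refine ⟨blockOf b, ⟨isBlock_blockOf hb, (hsub _ _).2 fun w hw h => ?_⟩, ?_⟩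
      · exact ConnectedComponent.eq.2 (((hbb w b hw hb).2 h).trans hvb.symm)
      · rintro S ⟨hS, hSc⟩
        obtain ⟨b', hb', rfl⟩ := hS.exists_eq_blockOf
        have h1 := ConnectedComponent.eq.1 ((hsub _ _).1 hSc b' hb' rfl)
        have h2 := (hbb _ _ hb' hb).1 (h1.trans hvb)
        unfold blockOf
        rw [h2]
    · obtain ⟨b, hb, rfl⟩ := hS.exists_eq_blockOf
      exact ⟨G.connectedComponentMk b, (hsub _ _).2 fun w hw h =>
        ConnectedComponent.eq.2 ((hbb w b hw hb).2 h)⟩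

/-! ### Composition of swaps and arithmetic of the six directions. -/

theorem swap_swap_left {V : Type*} {G : SimpleGraph V} {e e' : Sym2 V} {c d : V} (hcd : c ≠ d)
    (he : e ∈ G.edgeSet) (hne : e ≠ e') (hf : s(c, d) ≠ e') :
    swap (swap G e s(c, d)) e' e = swap G e' s(c, d) := by
  unfold swap
  congr 1
  rw [← swap, swap_edgeSet hcd]
  ext x
  simp only [Set.mem_insert_iff, Set.mem_sdiff, Set.mem_singleton_iff]
  by_cases h1 : x = e
  · subst h1; tauto
  · by_cases h2 : x = e'
    · subst h2; tauto
    · tauto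

theorem swap_swap_right {V : Type*} {G : SimpleGraph V} {e f : Sym2 V} {c d : V} (hcd : c ≠ d)
    (hf : s(c, d) = e ∨ s(c, d) ∉ G.edgeSet) :
    swap (swap G e s(c, d)) s(c, d) f = swap G e f := by
  unfold swap
  congr 1
  rw [← swap, swap_edgeSet hcd]
  ext x
  simp only [Set.mem_insert_iff, Set.mem_sdiff, Set.mem_singleton_iff]
  by_cases h1 : x = s(c, d)
  · subst h1; tauto
  · tauto

theorem swap_self {V : Type*} {G : SimpleGraph V} {e : Sym2 V} (he : e ∈ G.edgeSet) :
    swap G e e = G := by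
  have : insert e (G.edgeSet \ {e}) = G.edgeSet := by
    ext x
    simp only [Set.mem_insert_iff, Set.mem_sdiff, Set.mem_singleton_iff]
    by_cases h1 : x = e
    · subst h1; tauto
    · tauto
  rw [swap, this, fromEdgeSet_edgeSet]

theorem dir_add_three (d : Fin 6) : dir (d + 3) = -dir d := by
  revert d; decide

theorem dir_sub (d e f : Fin 6) (h : dir e = dir d + dir f) : e = d + 1 ∨ d = e + 1 := by
  revert d e f; decide

theorem dir_ne_zero (d : Fin 6) : dir d ≠ 0 := by
  revert d; decide

theorem dir_eq_dir_add (d : Fin 6) : dir d = dir (d + 1) + dir (d + 5) := by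
  revert d; decide

theorem dir_succ (d : Fin 6) : dir (d + 1) = dir d + dir (d + 2) := by
  revert d; decide

theorem ofNat_succ (k : ℕ) : Fin.ofNat 6 (k + 1) = Fin.ofNat 6 k + 1 := by
  ext; simp [Fin.ofNat, Fin.val_add]

theorem dir_injective : Function.Injective dir := by
  intro d e; revert d e; decide

/-! ### Undirected moves and their realisation by clockwise spins. -/

section Moves

variable {n : ℕ} {G : SimpleGraph (Vertex n)}

theorem lattice_adj {u v : Vertex n} : (lattice n).Adj u v ↔ ∃ d, v.1 = u.1 + dir d := by
  rw [lattice, fromRel_adj]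
  constructor
  · rintro ⟨-, h | ⟨d, hd⟩⟩
    · exact h
    · exact ⟨d + 3, by rw [dir_add_three, hd]; abel⟩
  · rintro ⟨d, hd⟩
    refine ⟨?_, .inl ⟨d, hd⟩⟩
    rintro rfl
    exact dir_ne_zero d (by simpa using hd.symm)

theorem lattice_adj_iff {u v : Vertex n} : (lattice n).Adj u v ↔
    (v.1.2 = u.1.2 + 1 ∧ (v.1.1 = u.1.1 - 1 ∨ v.1.1 = u.1.1 + 1)) ∨
    (v.1.2 = u.1.2 ∧ (v.1.1 = u.1.1 - 2 ∨ v.1.1 = u.1.1 + 2)) ∨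
    (v.1.2 = u.1.2 - 1 ∧ (v.1.1 = u.1.1 - 1 ∨ v.1.1 = u.1.1 + 1)) := by
  rw [lattice_adj]
  simp only [Prod.ext_iff, dir, Fin.exists_fin_succ]
  simp
  omega

theorem exists_vertex_add_dir {p : Vertex n} (hp : ¬ Boundary p) (d : Fin 6) :
    ∃ v : Vertex n, v.1 = p.1 + dir d := by
  have h := p.bounds
  unfold Boundary at hp
  suffices ∃ v : Vertex n, v.1.1 = p.1.1 + (dir d).1 ∧ v.1.2 = p.1.2 + (dir d).2 by
    obtain ⟨v, h1, h2⟩ := this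
    exact ⟨v, Prod.ext h1 h2⟩
  fin_cases d <;> refine exists_vertex ?_ ?_ ?_ ?_ <;> simp [dir] <;> omega

/-- The elementary moves: rotating an edge within a triangle of which two edges are present,
and moving the only edge at an interior leaf. -/
inductive Move {n : ℕ} (G : SimpleGraph (Vertex n)) : SimpleGraph (Vertex n) → Prop
  | triangle (x y z : Vertex n) (hxy : G.Adj x y) (hxz : G.Adj x z) (hyz : (lattice n).Adj y z) :
      Move G (swap G s(x, z) s(y, z))
  | leaf (p q r : Vertex n) (hp : ¬ Boundary p) (hq : ∀ x, G.Adj p x ↔ x = q)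
      (hr : (lattice n).Adj p r) : Move G (swap G s(p, q) s(p, r))

theorem swap_le_lattice (hG : G ≤ lattice n) {a b c d : Vertex n} (h : (lattice n).Adj c d) :
    swap G s(a, b) s(c, d) ≤ lattice n := by
  intro u v huv
  rw [swap_adj] at huv
  rcases huv with ⟨-, (⟨rfl, rfl⟩ | ⟨rfl, rfl⟩) | ⟨h', -⟩⟩
  · exact h
  · exact h.symm
  · exact hG h'

/-- The removed edge `xz` is replaced by the path through `y`, and the new edge `yz` by the path
through `x`; hence reachability does not change at all. -/
theorem IsGrove.swap_triangle (hG : IsGrove n G) {x y z : Vertex n} (hxy : G.Adj x y)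
    (hxz : G.Adj x z) (hyz : (lattice n).Adj y z) : IsGrove n (swap G s(x, z) s(y, z)) := by
  rw [isGrove_iff] at hG ⊢
  obtain ⟨hl, ha, hc, hb⟩ := hG
  have hxy' : (G.deleteEdges {s(x, z)}).Adj x y := by
    rw [deleteEdges_pair_adj]
    have := hxz.ne
    have := hyz.ne
    exact ⟨hxy, by tauto⟩
  have h1 : (swap G s(x, z) s(y, z)).Adj x y := by
    rw [swap_adj]
    exact ⟨hxy.ne, .inr (deleteEdges_pair_adj.1 hxy')⟩
  have h2 : (swap G s(x, z) s(y, z)).Adj y z := by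
    rw [swap_adj]
    exact ⟨hyz.ne, by simp⟩
  have hr : ∀ u v, (swap G s(x, z) s(y, z)).Reachable u v ↔ G.Reachable u v := by
    intro u v
    constructor <;> refine reachable_of_adj ?_
    · intro u v huv
      rw [swap_adj] at huv
      rcases huv with ⟨-, (⟨rfl, rfl⟩ | ⟨rfl, rfl⟩) | ⟨h', -⟩⟩
      · exact hxy.symm.reachable.trans hxz.reachable
      · exact hxz.symm.reachable.trans hxy.reachable
      · exact h'.reachable
    · intro u v huv
      by_cases h : (u = x ∧ v = z) ∨ (u = z ∧ v = x)
      · rcases h with ⟨rfl, rfl⟩ | ⟨rfl, rfl⟩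
        · exact h1.reachable.trans h2.reachable
        · exact h2.symm.reachable.trans h1.symm.reachable
      · exact (swap_adj.2 ⟨huv.ne, .inr ⟨huv, h⟩⟩ :
          (swap G s(x, z) s(y, z)).Adj u v).reachable
  refine ⟨swap_le_lattice hl hyz, isAcyclic_swap ha fun h => ?_, ?_, ?_⟩
  · exact not_reachable_deleteEdges ha hxz (hxy'.reachable.trans h)
  · simpa only [hr] using hc
  · simpa only [hr] using hb

/-- Only the component of the leaf `p` changes. As `p` is not on the boundary, no grove condition on
boundary vertices is affected. -/
theorem IsGrove.swap_leaf (hG : IsGrove n G) {p q r : Vertex n} (hp : ¬ Boundary p)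
    (hq : ∀ x, G.Adj p x ↔ x = q) (hpr : (lattice n).Adj p r) :
    IsGrove n (swap G s(p, q) s(p, r)) := by
  rw [isGrove_iff] at hG ⊢
  obtain ⟨hl, ha, hc, hb⟩ := hG
  have hpq : G.Adj p q := (hq q).2 rfl
  have hq' : ∀ x, G.Adj x p ↔ x = q := fun x => by rw [adj_comm, hq]
  have hadj : ∀ u v, u ≠ p → v ≠ p → ((swap G s(p, q) s(p, r)).Adj u v ↔ G.Adj u v) := by
    intro u v hu hv
    rw [swap_adj]
    have := fun h : G.Adj u v => h.ne
    tauto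
  have hr : ∀ u v, u ≠ p → v ≠ p →
      ((swap G s(p, q) s(p, r)).Reachable u v ↔ G.Reachable u v) := by
    classical
    intro u v hu hv
    constructor
    · intro h
      -- Retracting `p` onto `r` contracts the new edge `pr` and fixes all other edges; in the
      -- converse direction `p` is retracted onto `q`.
      have := reachable_map (K := G) (f := fun w => if w = p then r else w) ?_ h
      · simpa [hu, hv] using this
      · intro a b hab
        by_cases h1 : a = p
        · subst h1
          have h2 : b = r := by
            rw [swap_adj] at hab
            have := hab.1.symm
            rw [hq] at hab
            tauto
          simp [h2, hpr.ne.symm]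
        · by_cases h2 : b = p
          · subst h2
            have h2 : a = r := by
              rw [swap_adj] at hab
              rw [hq'] at hab
              tauto
            simp [h2, hpr.ne.symm]
          · simpa [h1, h2] using ((hadj a b h1 h2).1 hab).reachable
    · intro h
      have := reachable_map (K := swap G s(p, q) s(p, r)) (f := fun w => if w = p then q else w) ?_ h
      · simpa [hu, hv] using this
      · intro a b hab
        by_cases h1 : a = p
        · subst h1
          rw [hq] at hab
          subst hab
          simp
        · by_cases h2 : b = p
          · subst h2
            rw [hq'] at hab
            subst hab
            simp
          · simpa [h1, h2] using ((hadj a b h1 h2).2 hab).reachable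
  refine ⟨swap_le_lattice hl hpr, isAcyclic_swap ha fun h => ?_, ?_, ?_⟩
  · obtain ⟨w, hw⟩ := exists_adj_of_reachable h hpr.ne
    rw [deleteEdges_pair_adj, hq] at hw
    tauto
  · have key : ∀ v, v ≠ p → ∃ b, Boundary b ∧ (swap G s(p, q) s(p, r)).Reachable v b := by
      intro v hv
      obtain ⟨b, hbd, hvb⟩ := hc v
      exact ⟨b, hbd, (hr _ _ hv (by rintro rfl; exact hp hbd)).2 hvb⟩
    intro v
    by_cases hv : v = p
    · subst hv
      obtain ⟨b, hbd, hrb⟩ := key r hpr.ne.symm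
      refine ⟨b, hbd, Reachable.trans ?_ hrb⟩
      exact (swap_adj.2 ⟨hpr.ne, by simp⟩ : (swap G s(v, q) s(v, r)).Adj v r).reachable
    · exact key v hv
  · intro b b' hbd hbd'
    rw [hr _ _ (by rintro rfl; exact hp hbd) (by rintro rfl; exact hp hbd'), hb b b' hbd hbd']

theorem IsGrove.move (hG : IsGrove n G) {G' : SimpleGraph (Vertex n)} (h : Move G G') :
    IsGrove n G' := by
  cases h with
  | triangle x y z hxy hxz hyz => exact hG.swap_triangle hxy hxz hyz
  | leaf p q r hp hq hr => exact hG.swap_leaf hp hq hr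

theorem IsGrove.moves (hG : IsGrove n G) {G' : SimpleGraph (Vertex n)}
    (h : Relation.ReflTransGen Move G G') : IsGrove n G' := by
  induction h with
  | refl => exact hG
  | tail _ h ih => exact ih.move h

theorem GroveStep.of_swap (hG : IsGrove n G) {p q r : Vertex n} {d : Fin 6}
    (hq : q.1 = p.1 + dir d) (hr : r.1 = p.1 + dir (d + 1)) (hpq : G.Adj p q)
    (hpr : ¬ G.Adj p r) (hG' : IsGrove n (swap G s(p, q) s(p, r))) :
    GroveStep n G (swap G s(p, q) s(p, r)) := by
  refine ⟨hG, hG', p, q, r, d, hq, hr, hpq, hpr, swap_edgeSet ?_⟩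
  exact (lattice_adj.2 ⟨_, hr⟩).ne

/-- The pivot is `z`: seen from there, `x` lies in direction `d + 4` and `y` in direction `d + 5`.
-/
theorem groveStep_triangle (hG : IsGrove n G) {x y z : Vertex n} {d : Fin 6}
    (hy : y.1 = x.1 + dir d) (hz : z.1 = x.1 + dir (d + 1)) (hxy : G.Adj x y) (hxz : G.Adj x z) :
    GroveStep n G (swap G s(x, z) s(y, z)) := by
  have hyz : (lattice n).Adj z y := lattice_adj.2 ⟨d + 5, by
    rw [hy, hz, dir_eq_dir_add d, add_assoc]⟩
  have h := hG.swap_triangle hxy hxz hyz.symm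
  rw [Sym2.eq_swap (a := x), Sym2.eq_swap (a := y)] at h ⊢
  refine GroveStep.of_swap hG (d := d + 4) ?_ ?_ hxz.symm ?_ h
  · rw [hz, show d + 4 = d + 1 + 3 by rw [add_assoc]; rfl, dir_add_three]
    abel
  · rw [hy, hz, dir_eq_dir_add d, add_assoc, show d + 4 + 1 = d + 5 by rw [add_assoc]; rfl]
  · exact fun h' => not_triangle hG.acyclic hxz h' hxy

theorem groveStep_of_move (hG : IsGrove n G) {G' : SimpleGraph (Vertex n)} (h : Move G G') :
    Relation.ReflTransGen (GroveStep n) G G' := by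
  cases h with
  | triangle x y z hxy hxz hyz =>
    obtain ⟨d, hd⟩ := lattice_adj.1 (hG.le_lattice hxy)
    obtain ⟨e, he⟩ := lattice_adj.1 (hG.le_lattice hxz)
    obtain ⟨f, hf⟩ := lattice_adj.1 hyz
    rcases dir_sub d e f (by rw [hd, he] at hf; simpa [add_assoc] using hf) with rfl | rfl
    · exact .single (groveStep_triangle hG hd he hxy hxz)
    -- This is the counterclockwise case. Two clockwise spins are used: `xy` becomes `zy`, and then
    -- `zx` becomes `yx`, so that in total `xz` has been replaced by `yz`.
    · have h1 := groveStep_triangle hG he hd hxz hxy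
      have hyz' : ¬ G.Adj y z := fun h' => not_triangle hG.acyclic hxy h' hxz
      have hyz2 : ¬ G.Adj z y := fun h' => hyz' h'.symm
      have hne := hxy.ne
      have hne' := hxz.ne
      have hne2 := hyz.ne
      have hzy : (swap G s(x, y) s(z, y)).Adj z y := swap_adj.2 ⟨hyz.ne.symm, by simp⟩
      have hzx : (swap G s(x, y) s(z, y)).Adj z x := swap_adj.2 ⟨hxz.ne.symm, by
        right; exact ⟨hxz.symm, by tauto⟩⟩
      have h2 := groveStep_triangle (d := e + 2) h1.2.1 ?_ ?_ hzy hzx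
      · refine (Relation.ReflTransGen.single h1).tail ?_
        convert h2 using 1
        rw [Sym2.eq_swap (a := x) (b := z), Sym2.eq_swap (a := x) (b := y),
          Sym2.eq_swap (a := y) (b := z)]
        refine (swap_swap_left hyz.ne.symm hxy.symm ?_ ?_).symm
        · rw [Ne, Sym2.eq_iff]; tauto
        · rw [Ne, Sym2.eq_iff]; tauto
      · rw [hd, he]
        rw [dir_succ, add_assoc]
      · rw [he, show e + 2 + 1 = e + 3 by rw [add_assoc]; rfl, dir_add_three]
        abel
  | leaf p q r hp hq hr =>
    obtain ⟨d, hd⟩ := lattice_adj.1 (hG.le_lattice ((hq q).2 rfl))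
    obtain ⟨e, he⟩ := lattice_adj.1 hr
    -- Induction on the number `k` of clockwise turns. An interior vertex has all six neighbours, so
    -- the leaf edge never gets stuck, and every intermediate graph is a grove.
    have key : ∀ (k : ℕ) (r : Vertex n), r.1 = p.1 + dir (d + Fin.ofNat 6 k) →
        Relation.ReflTransGen (GroveStep n) G (swap G s(p, q) s(p, r)) := by
      intro k
      induction k with
      | zero =>
        intro r hr
        have : r = q := Subtype.ext (by rw [hr, hd]; simp)
        subst this
        rw [swap_self ((hq r).2 rfl)]
      | succ k ih =>
        intro r hr
        obtain ⟨s, hs⟩ := exists_vertex_add_dir hp (d + Fin.ofNat 6 k)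
        have hps : (lattice n).Adj p s := lattice_adj.2 ⟨_, hs⟩
        have hpr : (lattice n).Adj p r := lattice_adj.2 ⟨_, hr⟩
        have hG' := hG.swap_leaf hp hq hps
        have hrs : r ≠ s := by
          rintro rfl
          have := dir_injective (add_left_cancel (hs.symm.trans hr))
          have := add_left_cancel this
          rw [ofNat_succ] at this
          simp at this
        have heq : swap G s(p, q) s(p, r) = swap (swap G s(p, q) s(p, s)) s(p, s) s(p, r) := by
          refine (swap_swap_right hps.ne ?_).symm
          rw [mem_edgeSet, hq]
          by_cases h : s = q
          · exact .inl (by rw [h])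
          · exact .inr h
        refine (ih s hs).tail ?_
        rw [heq]
        refine GroveStep.of_swap hG' hs (by rw [hr, ofNat_succ, add_assoc]) ?_ ?_ ?_
        · exact swap_adj.2 ⟨hps.ne, by simp⟩
        · rw [swap_adj, hq]
          have := hps.ne
          tauto
        · rw [← heq]
          exact hG.swap_leaf hp hq hpr
    refine key (e - d).val r ?_
    rw [he]
    simp

theorem groveStep_of_moves (hG : IsGrove n G) {G' : SimpleGraph (Vertex n)}
    (h : Relation.ReflTransGen Move G G') : Relation.ReflTransGen (GroveStep n) G G' := by
  induction h with
  | refl => exact .refl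
  | tail h h' ih => exact ih.trans (groveStep_of_move (hG.moves h) h')

end Moves

/-! ### Incidence between the triangles of sizes `m + 2` and `m`. -/

section Incidence

variable {m : ℕ}

/-- The vertex `p` of the triangle of size `m + 2` is a corner of the upward unit triangle with
apex `o`. -/
def Inc (p : Vertex (m + 2)) (o : Vertex m) : Prop :=
  (p.1.2 = o.1.2 ∧ p.1.1 = o.1.1) ∨ (p.1.2 = o.1.2 - 1 ∧ (p.1.1 = o.1.1 - 1 ∨ p.1.1 = o.1.1 + 1))

theorem vertex_ne {n : ℕ} {u v : Vertex n} (h : u ≠ v) : ¬ (u.1.1 = v.1.1 ∧ u.1.2 = v.1.2) :=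
  fun h' => h (vertex_ext h'.1 h'.2)

/-- Distinct upward unit triangles share at most one corner. Consequently every edge belongs to the
star of a single `o`, and dually. -/
theorem Inc.linear {p q : Vertex (m + 2)} {o o' : Vertex m} (h1 : Inc p o) (h2 : Inc q o)
    (h3 : Inc p o') (h4 : Inc q o') (hpq : p ≠ q) : o = o' := by
  have := vertex_ne hpq
  unfold Inc at *
  apply vertex_ext <;> omega

theorem Inc.abscissa {p : Vertex (m + 2)} {o : Vertex m} (h : Inc p o) :
    -1 ≤ p.1.1 - o.1.1 ∧ p.1.1 - o.1.1 ≤ 1 := by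
  unfold Inc at h
  omega

theorem Inc.abscissa_ne {p q : Vertex (m + 2)} {o : Vertex m} (h1 : Inc p o) (h2 : Inc q o)
    (hpq : p ≠ q) : p.1.1 ≠ q.1.1 := by
  intro h
  unfold Inc at *
  exact hpq (vertex_ext h (by omega))

theorem Inc.abscissa_ne' {p : Vertex (m + 2)} {o o' : Vertex m} (h1 : Inc p o) (h2 : Inc p o')
    (hoo : o ≠ o') : o.1.1 ≠ o'.1.1 := by
  intro h
  unfold Inc at *
  exact hoo (vertex_ext h (by omega))

/-- The corners of an upward triangle have distinct abscissas among three consecutive integers, so a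
fourth corner is impossible. -/
theorem Inc.three {p q r x : Vertex (m + 2)} {o : Vertex m} (h1 : Inc p o) (h2 : Inc q o)
    (h3 : Inc r o) (h4 : Inc x o) (hpq : p ≠ q) (hpr : p ≠ r) (hqr : q ≠ r) :
    x = p ∨ x = q ∨ x = r := by
  by_contra! h
  have := h1.abscissa_ne h2 hpq
  have := h1.abscissa_ne h3 hpr
  have := h2.abscissa_ne h3 hqr
  have := h4.abscissa_ne h1 h.1
  have := h4.abscissa_ne h2 h.2.1
  have := h4.abscissa_ne h3 h.2.2
  have := h1.abscissa
  have := h2.abscissa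
  have := h3.abscissa
  have := h4.abscissa
  omega

theorem Inc.three' {p q r x : Vertex m} {o : Vertex (m + 2)} (h1 : Inc o p) (h2 : Inc o q)
    (h3 : Inc o r) (h4 : Inc o x) (hpq : p ≠ q) (hpr : p ≠ r) (hqr : q ≠ r) :
    x = p ∨ x = q ∨ x = r := by
  by_contra! h
  have := h1.abscissa_ne' h2 hpq
  have := h1.abscissa_ne' h3 hpr
  have := h2.abscissa_ne' h3 hqr
  have := h4.abscissa_ne' h1 h.1
  have := h4.abscissa_ne' h2 h.2.1
  have := h4.abscissa_ne' h3 h.2.2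
  have := h1.abscissa
  have := h2.abscissa
  have := h3.abscissa
  have := h4.abscissa
  omega

theorem Inc.lattice_adj {p q : Vertex (m + 2)} {o : Vertex m} (h1 : Inc p o) (h2 : Inc q o)
    (hpq : p ≠ q) : (lattice (m + 2)).Adj p q := by
  have := vertex_ne hpq
  rw [lattice_adj_iff]
  unfold Inc at *
  omega

theorem Inc.lattice_adj' {p : Vertex (m + 2)} {o o' : Vertex m} (h1 : Inc p o) (h2 : Inc p o')
    (h : o ≠ o') : (lattice m).Adj o o' := by
  have := vertex_ne h
  rw [lattice_adj_iff]
  unfold Inc at *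
  omega

theorem exists_inc_of_lattice_adj {o o' : Vertex m} (h : (lattice m).Adj o o') :
    ∃ p, Inc p o ∧ Inc p o' := by
  rw [lattice_adj_iff] at h
  have h1 := o.bounds
  have h2 := o'.bounds
  unfold Inc
  rcases h with ⟨h, h'⟩ | ⟨h, h'⟩ | ⟨h, h'⟩
  · obtain ⟨p, hx, hy⟩ := exists_vertex (n := m + 2) (x := o.1.1) (y := o.1.2) (by omega)
      (by omega) (by omega) (by push_cast; omega)
    exact ⟨p, by omega⟩
  · rcases h' with h' | h'
    · obtain ⟨p, hx, hy⟩ := exists_vertex (n := m + 2) (x := o.1.1 - 1) (y := o.1.2 - 1) (by omega)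
        (by omega) (by omega) (by push_cast; omega)
      exact ⟨p, by omega⟩
    · obtain ⟨p, hx, hy⟩ := exists_vertex (n := m + 2) (x := o.1.1 + 1) (y := o.1.2 - 1) (by omega)
        (by omega) (by omega) (by push_cast; omega)
      exact ⟨p, by omega⟩
  · obtain ⟨p, hx, hy⟩ := exists_vertex (n := m + 2) (x := o'.1.1) (y := o'.1.2) (by omega)
      (by omega) (by omega) (by push_cast; omega)
    exact ⟨p, by omega⟩

/-- A boundary vertex lies in at most one of the indexed upward triangles. -/
theorem Inc.not_boundary {p : Vertex (m + 2)} {o o' : Vertex m} (h1 : Inc p o) (h2 : Inc p o')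
    (h : o ≠ o') : ¬ Boundary p := by
  have := vertex_ne h
  have := o.bounds
  have := o'.bounds
  have := p.bounds
  unfold Boundary
  unfold Inc at *
  push_cast at *
  omega

theorem exists_inc_triple (o : Vertex m) : ∃ p q r : Vertex (m + 2), p ≠ q ∧ p ≠ r ∧ q ≠ r ∧
    ∀ x, Inc x o ↔ x = p ∨ x = q ∨ x = r := by
  have h1 := o.bounds
  obtain ⟨p, hpx, hpy⟩ := exists_vertex (n := m + 2) (x := o.1.1) (y := o.1.2) (by omega)
    (by omega) (by omega) (by push_cast; omega)
  obtain ⟨q, hqx, hqy⟩ := exists_vertex (n := m + 2) (x := o.1.1 - 1) (y := o.1.2 - 1) (by omega)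
    (by omega) (by omega) (by push_cast; omega)
  obtain ⟨r, hrx, hry⟩ := exists_vertex (n := m + 2) (x := o.1.1 + 1) (y := o.1.2 - 1) (by omega)
    (by omega) (by omega) (by push_cast; omega)
  have hpq : p ≠ q := by rintro rfl; omega
  have hpr : p ≠ r := by rintro rfl; omega
  have hqr : q ≠ r := by rintro rfl; omega
  refine ⟨p, q, r, hpq, hpr, hqr, fun x => ⟨fun h => ?_, ?_⟩⟩
  · exact Inc.three (by unfold Inc; omega) (by unfold Inc; omega) (by unfold Inc; omega) h
      hpq hpr hqr
  · rintro (rfl | rfl | rfl) <;> unfold Inc <;> omega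

theorem exists_inc_ne (o : Vertex m) (p : Vertex (m + 2)) : ∃ q, q ≠ p ∧ Inc q o := by
  obtain ⟨a, b, _, hab, -, -, h⟩ := exists_inc_triple o
  by_cases hp : a = p
  · exact ⟨b, by rw [← hp]; exact hab.symm, (h b).2 (by simp)⟩
  · exact ⟨a, hp, (h a).2 (by simp)⟩

/-- For an interior `o`, the downward triangle belonging to a corner `p` has further vertices inside
the small triangle. -/
theorem Inc.exists_ne {p : Vertex (m + 2)} {o : Vertex m} (ho : ¬ Boundary o) (h : Inc p o) :
    ∃ o', o' ≠ o ∧ Inc p o' := by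
  have h1 := o.bounds
  unfold Boundary at ho
  suffices ∃ o' : Vertex m, ¬ (o'.1.1 = o.1.1 ∧ o'.1.2 = o.1.2) ∧ Inc p o' by
    obtain ⟨o', h1, h2⟩ := this
    exact ⟨o', by rintro rfl; (simp at h1), h2⟩
  unfold Inc at *
  rcases h with h | h
  · obtain ⟨o', hx, hy⟩ := exists_vertex (n := m) (x := p.1.1 + 1) (y := p.1.2 + 1) (by omega)
      (by omega) (by omega) (by omega)
    exact ⟨o', by omega⟩
  · obtain ⟨o', hx, hy⟩ := exists_vertex (n := m) (x := p.1.1) (y := p.1.2) (by omega)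
      (by omega) (by omega) (by omega)
    exact ⟨o', by omega⟩

end Incidence

/-! ### Star graphs of a relation and their moves. -/

/-- The graph in which, for every `o`, the points incident with `o` form a star with
centre `c o`. -/
def star {P O : Type*} (H : P → O → Prop) (c : O → P) : SimpleGraph P where
  Adj p q := p ≠ q ∧ ∃ o, H p o ∧ H q o ∧ (p = c o ∨ q = c o)
  symm := ⟨fun p q => by
    rintro ⟨h, o, h1, h2, h3⟩
    exact ⟨h.symm, o, h2, h1, h3.symm⟩⟩
  loopless := ⟨fun p h => h.1 rfl⟩

theorem star_adj {P O : Type*} {H : P → O → Prop} {c : O → P} {p q : P} :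
    (star H c).Adj p q ↔ p ≠ q ∧ ∃ o, H p o ∧ H q o ∧ (p = c o ∨ q = c o) :=
  Iff.rfl

/-- A subrelation of the incidence relation together with a choice of centres. -/
structure Valid {m : ℕ} (H : Vertex (m + 2) → Vertex m → Prop) (c : Vertex m → Vertex (m + 2)) :
    Prop where
  inc : ∀ {p o}, H p o → Inc p o
  center : ∀ o, H (c o) o

/-- The incidence `(p, o)` is replaced with `(p', o')`. -/
def exchange {P O : Type*} (H : P → O → Prop) (p : P) (o : O) (p' : P) (o' : O) :
    P → O → Prop :=
  fun a b => (H a b ∧ ¬ (a = p ∧ b = o)) ∨ (a = p' ∧ b = o')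

theorem star_congr {P O : Type*} {H H' : P → O → Prop} {c c' : O → P}
    (h : ∀ o p q, p ≠ q →
      (H p o ∧ H q o ∧ (p = c o ∨ q = c o) ↔ H' p o ∧ H' q o ∧ (p = c' o ∨ q = c' o))) :
    star H c = star H' c' := by
  ext u v
  rw [star_adj, star_adj]
  exact and_congr_right fun huv => exists_congr fun o => h o u v huv

/-- A non-central point contributes exactly the edge to its centre, and by `hlin` no other star
contains that edge; moving the incidence therefore moves one edge. -/
theorem star_exchange {P O : Type*} {H : P → O → Prop} {c : O → P}
    (hlin : ∀ {p q o o'}, p ≠ q → H p o → H q o → H p o' → H q o' → o = o') {p p' : P} {o o' : O}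
    (hp : H p o) (hpc : p ≠ c o) (hp' : ¬ H p' o') (hco : H (c o) o) (hc : H (c o') o') :
    star (exchange H p o p' o') c = swap (star H c) s(p, c o) s(p', c o') := by
  have hpc' : p' ≠ c o' := by
    rintro rfl
    exact hp' hc
  ext u v
  rw [swap_adj, star_adj, star_adj]
  refine and_congr_right fun huv => ?_
  constructor
  · rintro ⟨b, (⟨h1, h1'⟩ | ⟨rfl, rfl⟩), (⟨h2, h2'⟩ | ⟨hvp, hb⟩), h3⟩
    · refine .inr ⟨⟨huv, b, h1, h2, h3⟩, ?_⟩
      rintro (⟨rfl, rfl⟩ | ⟨rfl, rfl⟩)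
      · exact h1' ⟨rfl, hlin huv h1 h2 hp hco⟩
      · exact h2' ⟨rfl, hlin huv h1 h2 hco hp⟩
    · subst hvp hb
      left; right; exact ⟨h3.resolve_right hpc', rfl⟩
    · left; left; exact ⟨rfl, h3.resolve_left hpc'⟩
    · exact absurd hvp.symm huv
  · have hc' : exchange H p o p' o' (c o') o' := by
      refine .inl ⟨hc, ?_⟩
      rintro ⟨h1, rfl⟩
      exact hpc h1.symm
    rintro ((⟨rfl, rfl⟩ | ⟨rfl, rfl⟩) | ⟨⟨-, b, h1, h2, h3⟩, h4⟩)
    · exact ⟨o', .inr ⟨rfl, rfl⟩, hc', .inr rfl⟩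
    · exact ⟨o', hc', .inr ⟨rfl, rfl⟩, .inl rfl⟩
    · refine ⟨b, .inl ⟨h1, ?_⟩, .inl ⟨h2, ?_⟩, h3⟩
      · rintro ⟨rfl, rfl⟩
        exact h4 (.inl ⟨rfl, h3.resolve_left hpc⟩)
      · rintro ⟨rfl, rfl⟩
        exact h4 (.inr ⟨h3.resolve_right hpc, rfl⟩)

/-- On three points, the stars centred at `c o` and at `x` share the edge between these two points
and differ only in where `z` is attached. -/
theorem star_update {P O : Type*} [DecidableEq O] {H : P → O → Prop} {c : O → P}
    (hlin : ∀ {p q o o'}, p ≠ q → H p o → H q o → H p o' → H q o' → o = o') {x z : P} {o : O}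
    (hx : H x o) (hzo : H z o) (hc : H (c o) o) (hxc : x ≠ c o) (hzx : z ≠ x) (hzc : z ≠ c o)
    (hall : ∀ y, H y o → y = c o ∨ y = x ∨ y = z) :
    star H (Function.update c o x) = swap (star H c) s(c o, z) s(x, z) := by
  ext u v
  rw [swap_adj, star_adj, star_adj]
  refine and_congr_right fun huv => ?_
  constructor
  · rintro ⟨b, hub, hvb, h3⟩
    by_cases hb : b = o
    · subst hb
      rw [Function.update_self] at h3
      by_cases h4 : (u = x ∧ v = z) ∨ (u = z ∧ v = x)
      · exact .inl h4
      · refine .inr ⟨⟨huv, b, hub, hvb, ?_⟩, ?_⟩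
        · rcases hall u hub with rfl | rfl | rfl <;> rcases hall v hvb with rfl | rfl | rfl <;>
            tauto
        · rintro (⟨rfl, rfl⟩ | ⟨rfl, rfl⟩) <;> tauto
    · rw [Function.update_of_ne hb] at h3
      refine .inr ⟨⟨huv, b, hub, hvb, h3⟩, ?_⟩
      rintro (⟨rfl, rfl⟩ | ⟨rfl, rfl⟩)
      · exact hb (hlin huv hub hvb hc hzo)
      · exact hb (hlin huv hub hvb hzo hc)
  · rintro ((⟨rfl, rfl⟩ | ⟨rfl, rfl⟩) | ⟨⟨-, b, hub, hvb, h3⟩, h4⟩)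
    · exact ⟨o, hx, hzo, by simp⟩
    · exact ⟨o, hzo, hx, by simp⟩
    · refine ⟨b, hub, hvb, ?_⟩
      by_cases hb : b = o
      · subst hb
        rw [Function.update_self]
        rcases hall u hub with rfl | rfl | rfl <;> rcases hall v hvb with rfl | rfl | rfl <;>
          tauto
      · rwa [Function.update_of_ne hb]

section Star

variable {m : ℕ} {H H' K : Vertex (m + 2) → Vertex m → Prop} {c : Vertex m → Vertex (m + 2)}

theorem Valid.exchange (h : Valid H c) {p p' : Vertex (m + 2)} {o o' : Vertex m} (hpc : p ≠ c o)
    (hp' : Inc p' o') : Valid (exchange H p o p' o') c := by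
  constructor
  · rintro a b (⟨h1, -⟩ | ⟨rfl, rfl⟩)
    · exact h.inc h1
    · exact hp'
  · intro b
    refine .inl ⟨h.center b, ?_⟩
    rintro ⟨h1, rfl⟩
    exact hpc h1.symm

theorem Valid.linear (h : Valid H c) {p q : Vertex (m + 2)} {o o' : Vertex m} (hpq : p ≠ q)
    (h1 : H p o) (h2 : H q o) (h3 : H p o') (h4 : H q o') : o = o' :=
  Inc.linear (h.inc h1) (h.inc h2) (h.inc h3) (h.inc h4) hpq

theorem Valid.recenter (h : Valid H c) {x : Vertex (m + 2)} {o : Vertex m} (hx : H x o) :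
    Valid H (Function.update c o x) ∧
      Relation.ReflTransGen Move (star H c) (star H (Function.update c o x)) := by
  have hv : Valid H (Function.update c o x) := by
    refine ⟨h.inc, fun b => ?_⟩
    by_cases hb : b = o
    · subst hb; simpa using hx
    · simpa [hb] using h.center b
  refine ⟨hv, ?_⟩
  by_cases hxc : x = c o
  · rw [hxc, Function.update_eq_self]
  have hc := h.center o
  by_cases hz : ∃ z, H z o ∧ z ≠ x ∧ z ≠ c o
  · obtain ⟨z, hzo, hzx, hzc⟩ := hz
    have hall : ∀ y, H y o → y = c o ∨ y = x ∨ y = z := fun y hy =>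
      Inc.three (h.inc hc) (h.inc hx) (h.inc hzo) (h.inc hy) (Ne.symm hxc) hzc.symm hzx.symm
    have h1 : (star H c).Adj (c o) x := star_adj.2 ⟨Ne.symm hxc, o, hc, hx, .inl rfl⟩
    have h2 : (star H c).Adj (c o) z := star_adj.2 ⟨hzc.symm, o, hc, hzo, .inl rfl⟩
    refine .single ?_
    convert Move.triangle _ _ _ h1 h2 (Inc.lattice_adj (h.inc hx) (h.inc hzo) hzx.symm) using 1
    exact star_update h.linear hx hzo hc hxc hzx hzc hall
  -- Only `x` and `c o` are left at `o`; the star is a single edge, which does not depend on the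
  -- centre.
  · push Not at hz
    convert Relation.ReflTransGen.refl using 1
    ext u v
    rw [star_adj, star_adj]
    refine and_congr_right fun huv => exists_congr fun b => and_congr_right fun hub =>
      and_congr_right fun hvb => ?_
    by_cases hb : b = o
    · subst hb
      rw [Function.update_self]
      have := hz u hub
      have := hz v hvb
      by_cases h5 : u = x <;> by_cases h6 : v = x <;> simp_all
    · rw [Function.update_of_ne hb]

/-- Groves over `H` can be moved to groves over `H'`. -/
def MovesTo (H H' : Vertex (m + 2) → Vertex m → Prop) : Prop :=
  ∀ c, Valid H c → IsGrove (m + 2) (star H c) →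
    ∃ c', Valid H' c' ∧ Relation.ReflTransGen Move (star H c) (star H' c')

theorem MovesTo.refl (H : Vertex (m + 2) → Vertex m → Prop) : MovesTo H H :=
  fun c hc _ => ⟨c, hc, .refl⟩

theorem MovesTo.trans (h1 : MovesTo H H') (h2 : MovesTo H' K) : MovesTo H K := by
  intro c hc hG
  obtain ⟨c', hc', h⟩ := h1 c hc hG
  obtain ⟨c2, hc2, h'⟩ := h2 c' hc' (hG.moves h)
  exact ⟨c2, hc2, h.trans h'⟩

/-- A triangle with a single related point contributes no edges, so the graph does not change. -/
theorem movesTo_upper_leaf {p p' : Vertex (m + 2)} {o : Vertex m} (hp : ∀ x, H x o ↔ x = p)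
    (hp' : Inc p' o) : MovesTo H (exchange H p o p' o) := by
  intro c hc _
  refine ⟨Function.update c o p', ⟨?_, fun b => ?_⟩, ?_⟩
  · rintro a b (⟨h1, -⟩ | ⟨rfl, rfl⟩)
    · exact hc.inc h1
    · exact hp'
  · by_cases hb : b = o
    · subst hb; simp [exchange]
    · simpa [hb, exchange] using hc.center b
  · convert Relation.ReflTransGen.refl using 1
    ext u v
    rw [star_adj, star_adj]
    refine and_congr_right fun huv => exists_congr fun b => ?_
    by_cases hb : b = o
    · subst hb
      simp only [exchange, hp]
      constructor
      · rintro ⟨h1, h2, -⟩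
        exact absurd ((h1.resolve_left (by tauto)).1.trans
          (h2.resolve_left (by tauto)).1.symm) huv
      · rintro ⟨rfl, rfl, -⟩
        exact absurd rfl huv
    · simp [exchange, hb]

theorem IsGrove.exists_adj {n : ℕ} {G : SimpleGraph (Vertex n)} (hG : IsGrove n G) {p : Vertex n}
    (hp : ¬ Boundary p) : ∃ q, G.Adj p q := by
  obtain ⟨b, hb, hpb⟩ := (isGrove_iff.1 hG).2.2.1 p
  exact exists_adj_of_reachable hpb (by rintro rfl; exact hp hb)

/-- If `o` is the only triangle used at `p`, recentring `o` at a neighbour of `p` makes `p` a leaf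
of the grove. When `o ≠ o'`, the vertex `p` is interior, and its edge may be turned into the
triangle `o'`. -/
theorem movesTo_lower_leaf {p : Vertex (m + 2)} {o o' : Vertex m} (ho : ∀ x, H p x ↔ x = o)
    (ho' : Inc p o') : MovesTo H (exchange H p o p o') := by
  intro c hc hG
  by_cases hoo : o = o'
  · subst hoo
    have : exchange H p o p o = H := by
      funext a b
      have := ho o
      simp only [exchange]
      by_cases h1 : a = p ∧ b = o
      · obtain ⟨rfl, rfl⟩ := h1; simp [this]
      · simp [h1]
    rw [this]
    exact MovesTo.refl H c hc hG
  have hpo : H p o := (ho o).2 rfl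
  have hint := Inc.not_boundary (hc.inc hpo) ho' hoo
  obtain ⟨q, hpq, b, hpb, hqb, -⟩ := hG.exists_adj hint
  rw [ho] at hpb
  subst hpb
  obtain ⟨hv, hm⟩ := hc.recenter hqb
  set c' := Function.update c b q with hc'
  have hcb : c' b = q := by simp [hc']
  have hpo' : ¬ H p o' := by rw [ho]; exact Ne.symm hoo
  have hpc : p ≠ c' b := by rw [hcb]; exact hpq
  refine ⟨c', hv.exchange hpc ho', hm.tail ?_⟩
  rw [star_exchange hv.linear hpo hpc hpo' (hv.center _) (hv.center _), hcb]
  refine Move.leaf _ _ _ hint (fun x => ?_) (Inc.lattice_adj ho' (hv.inc (hv.center o')) ?_)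
  · rw [star_adj]
    constructor
    · rintro ⟨hne, b', h1, h2, h3⟩
      rw [ho] at h1
      subst h1
      rw [hcb] at h3
      exact h3.resolve_left hpq
    · rintro rfl
      exact ⟨hpq, b, hpo, hqb, .inr hcb.symm⟩
  · intro h
    exact hpo' (h ▸ hv.center o')

/-- In the hexagon `p, o, q, oq, r, op` from which the incidence `(p', o')` is missing, the
incidence `(p, o)` can be exchanged for `(p', o')`. -/
theorem movesTo_hexagon {p q r p' : Vertex (m + 2)} {o op oq o' : Vertex m}
    (hpq : p ≠ q) (hpr : p ≠ r) (hqr : q ≠ r) (hop : o ≠ op) (hoq : o ≠ oq) (hopq : op ≠ oq)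
    (hp : H p o) (hq : H q o) (hp' : ¬ H p' o')
    (h' : ((p' = p ∨ p' = r) ∧ o' = op ∧ (H p op ∨ p' = p) ∧ (H r op ∨ p' = r) ∧ H q oq ∧ H r oq) ∨
      ((p' = q ∨ p' = r) ∧ o' = oq ∧ H p op ∧ H r op ∧ (H q oq ∨ p' = q) ∧ (H r oq ∨ p' = r)))
    (hinc : Inc p' o') : MovesTo H (exchange H p o p' o') := by
  intro c hc hG
  obtain ⟨hv1, hm1⟩ := hc.recenter hq
  set c1 := Function.update c o q with hc1
  rcases h' with ⟨hp'r, rfl, h1, h2, h3, h4⟩ | ⟨hp'r, rfl, h3, h4, h1, h2⟩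
  -- Let `x` be the corner among `p`, `r` other than `p'`, and take it as centre of `o'`, so that
  -- the added edge is `pr`. With `o` and `oq` centred at `q`, the edges `qp` and `qr` are present,
  -- and `qp` is rotated to `pr`.
  · obtain ⟨x, hx, hxo, hxp⟩ : ∃ x, ((x = p ∧ p' = r) ∨ (x = r ∧ p' = p)) ∧ H x o' ∧ x ≠ p' := by
      rcases hp'r with rfl | rfl
      · exact ⟨r, by simp, h2.resolve_right hpr, hpr.symm⟩
      · exact ⟨p, by simp, h1.resolve_right hpr.symm, hpr⟩
    obtain ⟨hv2, hm2⟩ := hv1.recenter hxo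
    set c2 := Function.update c1 o' x with hc2
    obtain ⟨hv3, hm3⟩ := hv2.recenter h3
    set c3 := Function.update c2 oq q with hc3
    have e1 : c3 o = q := by simp [hc3, hc2, hc1, hop, hoq]
    have e2 : c3 o' = x := by simp [hc3, hc2, hopq]
    have e3 : c3 oq = q := by simp [hc3]
    have hpc : p ≠ c3 o := by rw [e1]; exact hpq
    refine ⟨c3, hv3.exchange hpc hinc, ((hm1.trans hm2).trans hm3).tail ?_⟩
    rw [star_exchange hv3.linear hp hpc hp' (hv3.center _) (hv3.center _), e1, e2, Sym2.eq_swap (a := p)]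
    have a1 : (star H c3).Adj q r := star_adj.2 ⟨hqr, oq, h3, h4, .inl e3.symm⟩
    have a2 : (star H c3).Adj q p := star_adj.2 ⟨hpq.symm, o, hq, hp, .inl e1.symm⟩
    have hxl := Inc.lattice_adj hinc (hc.inc hxo) hxp.symm
    rcases hx with ⟨rfl, rfl⟩ | ⟨rfl, rfl⟩
    · exact Move.triangle _ _ _ a1 a2 hxl
    · rw [Sym2.eq_swap (a := p')]
      exact Move.triangle _ _ _ a1 a2 hxl.symm
  -- Here the added edge is `qr`. The triangle `op`, centred at `p`, supplies `pr`, and `pq` is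
  -- rotated to `qr`.
  · obtain ⟨x, hx, hxo, hxp⟩ : ∃ x, ((x = q ∧ p' = r) ∨ (x = r ∧ p' = q)) ∧ H x o' ∧ x ≠ p' := by
      rcases hp'r with rfl | rfl
      · exact ⟨r, by simp, h2.resolve_right hqr, hqr.symm⟩
      · exact ⟨q, by simp, h1.resolve_right hqr.symm, hqr⟩
    obtain ⟨hv2, hm2⟩ := hv1.recenter hxo
    set c2 := Function.update c1 o' x with hc2
    obtain ⟨hv3, hm3⟩ := hv2.recenter h3
    set c3 := Function.update c2 op p with hc3
    have e1 : c3 o = q := by simp [hc3, hc2, hc1, hop, hoq]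
    have e2 : c3 o' = x := by simp [hc3, hc2, hopq.symm]
    have e3 : c3 op = p := by simp [hc3]
    have hpc : p ≠ c3 o := by rw [e1]; exact hpq
    refine ⟨c3, hv3.exchange hpc hinc, ((hm1.trans hm2).trans hm3).tail ?_⟩
    rw [star_exchange hv3.linear hp hpc hp' (hv3.center _) (hv3.center _), e1, e2]
    have a1 : (star H c3).Adj p r := star_adj.2 ⟨hpr, op, h3, h4, .inl e3.symm⟩
    have a2 : (star H c3).Adj p q := star_adj.2 ⟨hpq, o, hp, hq, .inr e1.symm⟩
    have hxl := Inc.lattice_adj hinc (hc.inc hxo) hxp.symm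
    rcases hx with ⟨rfl, rfl⟩ | ⟨rfl, rfl⟩
    · exact Move.triangle _ _ _ a1 a2 hxl
    · rw [Sym2.eq_swap (a := p')]
      exact Move.triangle _ _ _ a1 a2 hxl.symm

theorem finite_vertex (n : ℕ) : Finite (Vertex n) := by
  have : Set.Finite {p : ℤ × ℤ | |p.1| + |p.2| ≤ n ∧ p.2 ≤ 0 ∧ p.1 + p.2 ≡ n [ZMOD 2]} := by
    refine (Set.finite_Icc ((-n : ℤ), (-n : ℤ)) ((n : ℤ), (n : ℤ))).subset ?_
    rintro ⟨x, y⟩ h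
    have := mem_iff.1 h
    simp only [Set.mem_Icc, Prod.mk_le_mk]
    omega
  exact this

/-- Groves over the same relation are connected by moves. -/
theorem moves_recenter (hc : Valid H c) {c' : Vertex m → Vertex (m + 2)} (hc' : Valid H c') :
    Relation.ReflTransGen Move (star H c) (star H c') := by
  classical
  have := finite_vertex m
  have := Fintype.ofFinite (Vertex m)
  have key : ∀ S : Finset (Vertex m), Valid H (fun o => if o ∈ S then c' o else c o) ∧
      Relation.ReflTransGen Move (star H c) (star H fun o => if o ∈ S then c' o else c o) := by
    intro S
    induction S using Finset.induction_on with
    | empty => exact ⟨by simpa using hc, by simpa using .refl⟩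
    | insert o S ho ih =>
      have h := ih.1.recenter (hc'.center o)
      have heq : Function.update (fun o => if o ∈ S then c' o else c o) o (c' o) =
          fun b => if b ∈ insert o S then c' b else c b := by
        funext b
        by_cases hb : b = o
        · subst hb; simp
        · simp [hb]
      rw [heq] at h
      exact ⟨h.1, ih.2.trans h.2⟩
  simpa using (key Finset.univ).2

end Star

/-! ### The lower graph and the lifting of its moves. -/

section Lower

variable {m : ℕ} {H H' : Vertex (m + 2) → Vertex m → Prop} {d d' : Vertex (m + 2) → Vertex m}

/-- A subrelation of the incidence relation together with a choice of centres for the smaller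
triangle. -/
structure LowerValid {m : ℕ} (H : Vertex (m + 2) → Vertex m → Prop)
    (d : Vertex (m + 2) → Vertex m) : Prop where
  inc : ∀ {p o}, H p o → Inc p o
  center : ∀ {p o}, Inc p o → H p (d p)

/-- The graph on the smaller triangle described by a relation and a choice of centres. -/
abbrev lower {m : ℕ} (H : Vertex (m + 2) → Vertex m → Prop) (d : Vertex (m + 2) → Vertex m) :
    SimpleGraph (Vertex m) :=
  star (flip H) d

theorem lower_adj {u v : Vertex m} :
    (lower H d).Adj u v ↔ u ≠ v ∧ ∃ p, H p u ∧ H p v ∧ (u = d p ∨ v = d p) :=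
  Iff.rfl

theorem LowerValid.linear (h : LowerValid H d) {u v : Vertex m} {p q : Vertex (m + 2)}
    (huv : u ≠ v) (h1 : flip H u p) (h2 : flip H v p) (h3 : flip H u q) (h4 : flip H v q) :
    p = q := by
  by_contra hpq
  exact huv (Inc.linear (h.inc h1) (h.inc h3) (h.inc h2) (h.inc h4) hpq)

theorem LowerValid.adj_iff (h : LowerValid H d) {u v : Vertex m} {p : Vertex (m + 2)}
    (hu : Inc p u) (hv : Inc p v) (huv : u ≠ v) :
    (lower H d).Adj u v ↔ H p u ∧ H p v ∧ (u = d p ∨ v = d p) := by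
  rw [lower_adj]
  constructor
  · rintro ⟨-, q, h1, h2, h3⟩
    have : p = q := by
      by_contra hpq
      exact huv (Inc.linear hu (h.inc h1) hv (h.inc h2) hpq)
    subst this
    exact ⟨h1, h2, h3⟩
  · exact fun h => ⟨huv, p, h⟩

theorem LowerValid.mem_of_lower_eq (h : LowerValid H d) (h' : LowerValid H' d')
    (heq : lower H d = lower H' d') {p : Vertex (m + 2)} {u v : Vertex m} (hu : H p u)
    (hv : H p v) (huv : u ≠ v) : H' p u := by
  by_cases hd : u = d p
  · have h1 := (h.adj_iff (h.inc hu) (h.inc hv) huv).2 ⟨hu, hv, .inl hd⟩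
    rw [heq, h'.adj_iff (h.inc hu) (h.inc hv) huv] at h1
    exact h1.1
  · have hc := h.center (h.inc hu)
    have h1 := (h.adj_iff (h.inc hu) (h.inc hc) hd).2 ⟨hu, hc, .inr rfl⟩
    rw [heq, h'.adj_iff (h.inc hu) (h.inc hc) hd] at h1
    exact h1.1

/-- A star with at least two points is recovered from its edges by linearity. Only one-point stars
are invisible in the lower graph. -/
theorem LowerValid.eq_or_singleton (h : LowerValid H d) (h' : LowerValid H' d')
    (heq : lower H d = lower H' d') (p : Vertex (m + 2)) :
    H p = H' p ∨ ∃ o o', Inc p o ∧ Inc p o' ∧ (∀ x, H p x ↔ x = o) ∧ ∀ x, H' p x ↔ x = o' := by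
  by_cases hp : ∃ o, Inc p o
  · obtain ⟨o, ho⟩ := hp
    have hc := h.center ho
    have hc' := h'.center ho
    have key : ∀ u v, H p u → H p v → u ≠ v → H p = H' p := by
      intro u v hu hv huv
      have hu' := h.mem_of_lower_eq h' heq hu hv huv
      have hv' := h.mem_of_lower_eq h' heq hv hu huv.symm
      funext x
      refine propext ⟨fun hx => ?_, fun hx => ?_⟩
      · by_cases hxu : x = u
        · exact hxu ▸ hu'
        · exact h.mem_of_lower_eq h' heq hx hu hxu
      · by_cases hxu : x = u
        · exact hxu ▸ hu
        · exact h'.mem_of_lower_eq h heq.symm hx hu' hxu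
    have key' : ∀ u v, H' p u → H' p v → u ≠ v → H p = H' p := by
      intro u v hu hv huv
      have hu' := h'.mem_of_lower_eq h heq.symm hu hv huv
      have hv' := h'.mem_of_lower_eq h heq.symm hv hu huv.symm
      exact key u v hu' hv' huv
    by_cases hne : H p = H' p
    · exact .inl hne
    · refine .inr ⟨d p, d' p, h.inc hc, h'.inc hc', fun x => ⟨fun hx => ?_, ?_⟩,
        fun x => ⟨fun hx => ?_, ?_⟩⟩
      · by_contra hxd
        exact hne (key _ _ hx hc hxd)
      · rintro rfl; exact hc
      · by_contra hxd
        exact hne (key' _ _ hx hc' hxd)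
      · rintro rfl; exact hc'
  · left
    push Not at hp
    funext x
    exact propext ⟨fun hx => absurd (h.inc hx) (hp x), fun hx => absurd (h'.inc hx) (hp x)⟩

/-- Relations describing the same graph on the smaller triangle are connected by moves. -/
theorem movesTo_of_lower_eq (h : LowerValid H d) (h' : LowerValid H' d')
    (heq : lower H d = lower H' d') : MovesTo H H' := by
  classical
  have := finite_vertex (m + 2)
  have := Fintype.ofFinite (Vertex (m + 2))
  have key : ∀ S : Finset (Vertex (m + 2)), MovesTo H (fun p => if p ∈ S then H' p else H p) := by
    intro S
    induction S using Finset.induction_on with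
    | empty => simpa using MovesTo.refl H
    | insert p S hp ih =>
      refine ih.trans ?_
      rcases h.eq_or_singleton h' heq p with hpp | ⟨o, o', ho, ho', h1, h2⟩
      · convert MovesTo.refl _ using 1
        funext a
        by_cases ha : a = p
        · subst ha; simp [hp, hpp]
        · simp [ha]
      · have := movesTo_lower_leaf (H := fun p => if p ∈ S then H' p else H p) (p := p) (o := o)
          (o' := o') (by simpa [hp] using h1) ho'
        convert this using 1
        funext a b
        simp only [exchange]
        by_cases ha : a = p
        · subst ha
          simp only [Finset.mem_insert_self, if_true, hp, if_false, h1, h2, true_and]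
          apply propext
          tauto
        · simp [ha]
  simpa using key Finset.univ

/-- The relation can be changed, without changing the graph it describes, such that the star at
`p` is centred at a given vertex `y`. -/
theorem LowerValid.normalize (h : LowerValid H d) {p : Vertex (m + 2)} {y z : Vertex m}
    (hy : Inc p y) (hz : Inc p z) (hyz : y ≠ z) (hHz : ¬ H p z) :
    ∃ H' d', LowerValid H' d' ∧ lower H d = lower H' d' ∧ H' p y ∧ d' p = y ∧ ¬ H' p z ∧
      ∀ q, q ≠ p → H' q = H q ∧ d' q = d q := by
  have hc := h.center hy
  have hcz : d p ≠ z := by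
    intro h'
    exact hHz (h' ▸ hc)
  -- Without `z`, only `y` and `d p` can be related to `p`, so the star at `p` has at most one edge.
  -- If `y` is present it can serve as centre; otherwise the star is the lone point `d p`, which may
  -- be replaced by `y`.
  by_cases hHy : H p y
  · refine ⟨H, Function.update d p y, ⟨h.inc, fun {q o} hq => ?_⟩, star_congr fun q u v huv => ?_,
      hHy, by simp, hHz, fun q hq => ⟨rfl, by simp [hq]⟩⟩
    · by_cases hqp : q = p
      · subst hqp; simpa using hHy
      · simpa [hqp] using h.center hq
    · by_cases hqp : q = p
      · subst hqp
        rw [Function.update_self]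
        refine and_congr_right fun hu => and_congr_right fun hv => ?_
        by_cases hyd : y = d q
        · rw [hyd]
        · have key : ∀ x, H q x → x = y ∨ x = d q := by
            intro x hx
            have := Inc.three' hy (h.inc hc) hz (h.inc hx) hyd hyz hcz
            have : x ≠ z := fun h' => hHz (h' ▸ hx)
            tauto
          have := key u hu
          have := key v hv
          grind
      · rw [Function.update_of_ne hqp]
  · have hyd : y ≠ d p := fun h' => hHy (h' ▸ hc)
    have key : ∀ x, H p x ↔ x = d p := by
      intro x
      refine ⟨fun hx => ?_, ?_⟩
      · have := Inc.three' hy (h.inc hc) hz (h.inc hx) hyd hyz hcz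
        have : x ≠ z := fun h' => hHz (h' ▸ hx)
        have : x ≠ y := fun h' => hHy (h' ▸ hx)
        tauto
      · rintro rfl; exact hc
    refine ⟨Function.update H p (fun x => x = y), Function.update d p y,
      ⟨fun {q o} hq => ?_, fun {q o} hq => ?_⟩, star_congr fun q u v huv => ?_,
      by simp, by simp, by simpa using hyz.symm, fun q hq => ⟨by simp [hq], by simp [hq]⟩⟩
    · by_cases hqp : q = p
      · subst hqp
        rw [Function.update_self] at hq
        exact hq ▸ hy
      · rw [Function.update_of_ne hqp] at hq
        exact h.inc hq
    · by_cases hqp : q = p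
      · subst hqp; simp
      · simpa [hqp] using h.center hq
    · by_cases hqp : q = p
      · subst hqp
        simp only [flip, Function.update_self, key]
        grind
      · simp only [flip, Function.update_of_ne hqp]

theorem flip_exchange {P O : Type*} {H : P → O → Prop} {p p' : P} {o o' : O} :
    flip (exchange H p o p' o') = exchange (flip H) o p o' p' := by
  funext a b
  simp only [flip, exchange]
  apply propext
  tauto

theorem LowerValid.exchange (h : LowerValid H d) {p p' : Vertex (m + 2)} {o o' : Vertex m}
    (ho : o ≠ d p) (hinc : Inc p' o') : LowerValid (exchange H p o p' o') d := by
  constructor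
  · rintro a b (⟨h1, -⟩ | ⟨rfl, rfl⟩)
    · exact h.inc h1
    · exact hinc
  · intro a b hab
    refine .inl ⟨h.center hab, ?_⟩
    rintro ⟨rfl, h1⟩
    exact ho h1.symm

theorem LowerValid.lower_exchange (h : LowerValid H d) {p p' : Vertex (m + 2)} {o o' : Vertex m}
    (hp : H p o) (ho : o ≠ d p) (hinc : Inc p' o') (hp' : ¬ H p' o') :
    lower (Groves.exchange H p o p' o') d = swap (lower H d) s(o, d p) s(o', d p') := by
  rw [lower, flip_exchange]
  exact star_exchange h.linear hp ho hp' (h.center (h.inc hp)) (h.center hinc)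

/-- The relation is normalised, keeping the lower graph, until `p` is the only point related to `o`
and the stars at `p` and `p''` are centred at `o'` and `o''`. Moving the incidence of `o` from `p`
to `p''` then redirects the leaf edge below and changes nothing above. -/
theorem LowerValid.lift_leaf_of_ne (h : LowerValid H d) {o o' o'' : Vertex m}
    {p p'' : Vertex (m + 2)} (ho : ¬ Boundary o) (hleaf : ∀ x, (lower H d).Adj o x ↔ x = o')
    (hpo : Inc p o) (hpo' : Inc p o') (hpo2 : Inc p'' o) (hpo2' : Inc p'' o'') (hoo : o'' ≠ o)
    (hpp : p ≠ p'') :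
    ∃ H' d', LowerValid H' d' ∧ lower H' d' = swap (lower H d) s(o, o') s(o, o'') ∧
      MovesTo H H' := by
  classical
  have hadj := (hleaf o').2 rfl
  have hne : o ≠ o' := hadj.ne
  obtain ⟨hHo, hHo', hd⟩ := (h.adj_iff hpo hpo' hne).1 hadj
  have halt : ∀ q, ∃ a, Inc q o → a ≠ o ∧ Inc q a := by
    intro q
    by_cases hq : Inc q o
    · obtain ⟨a, h1, h2⟩ := hq.exists_ne ho
      exact ⟨a, fun _ => ⟨h1, h2⟩⟩
    · exact ⟨o, fun h => absurd h hq⟩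
  choose alt halt using halt
  -- A further point related to such a `q` would give the leaf `o` a second edge.
  have hsing : ∀ q, q ≠ p → H q o → ∀ x, H q x → x = o := by
    intro q hq hqo x hx
    by_contra hxo
    have : q = p := by
      by_cases hdq : d q = o
      · have := (hleaf x).1 ((h.adj_iff (h.inc hqo) (h.inc hx) (Ne.symm hxo)).2
          ⟨hqo, hx, .inl hdq.symm⟩)
        subst this
        exact h.linear hne hqo hx hHo hHo'
      · have hc := h.center (h.inc hx)
        have := (hleaf (d q)).1 ((h.adj_iff (h.inc hqo) (h.inc hc) (Ne.symm hdq)).2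
          ⟨hqo, hc, .inr rfl⟩)
        rw [this] at hc
        exact h.linear hne hqo hc hHo hHo'
    exact hq this
  -- The one-point stars at `o` away from `p` are diverted to another vertex `alt q`, and `p` is
  -- recentred at `o'`.
  set H1 : Vertex (m + 2) → Vertex m → Prop := fun q x => if q ≠ p ∧ H q o then x = alt q else H q x
    with hH1
  set d1 : Vertex (m + 2) → Vertex m := fun q =>
    if q ≠ p ∧ H q o then alt q else if q = p then o' else d q with hd1
  have hv1 : LowerValid H1 d1 := by
    constructor
    · intro q x hqx
      simp only [hH1] at hqx
      split_ifs at hqx with hq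
      · exact hqx ▸ (halt q (h.inc hq.2)).2
      · exact h.inc hqx
    · intro q x hqx
      simp only [hH1, hd1]
      split_ifs with hq hq'
      · rfl
      · exact hq' ▸ hHo'
      · exact h.center hqx
  have heq1 : lower H d = lower H1 d1 := by
    refine star_congr fun q u v huv => ?_
    simp only [flip, hH1, hd1]
    split_ifs with hq hq'
    · have := hsing q hq.1 hq.2
      constructor
      · rintro ⟨h1, h2, -⟩
        exact absurd ((this _ h1).trans (this _ h2).symm) huv
      · rintro ⟨h1, h2, -⟩
        exact absurd (h1.trans h2.symm) huv
    · subst hq'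
      refine and_congr_right fun hu => and_congr_right fun hv => ?_
      rcases hd with hd | hd
      · have key : ∀ x, H q x → x ≠ o → x = o' := by
          intro x hx hxo
          exact (hleaf x).1 ((h.adj_iff hpo (h.inc hx) hxo.symm).2 ⟨hHo, hx, .inl hd⟩)
        have := key u hu
        have := key v hv
        grind
      · rw [hd]
    · rfl
  have hN1 : ∀ q, H1 q o ↔ q = p := by
    intro q
    simp only [hH1]
    split_ifs with hq
    · constructor
      · intro h'
        exact absurd h'.symm (halt q (h.inc hq.2)).1
      · intro h'
        exact absurd h' hq.1
    · constructor
      · intro h'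
        by_contra hqp
        exact hq ⟨hqp, h'⟩
      · rintro rfl
        exact hHo
  have hd1p : d1 p = o' := by simp [hd1]
  obtain ⟨H2, d2, hv2, heq2, h2y, h2d, h2z, h2⟩ := hv1.normalize hpo2' hpo2 hoo
    (by rw [hN1]; exact hpp.symm)
  have hN2 : ∀ q, H2 q o ↔ q = p := by
    intro q
    by_cases hq : q = p''
    · subst hq
      exact ⟨fun h' => absurd h' h2z, fun h' => absurd h'.symm hpp⟩
    · rw [(h2 q hq).1, hN1]
  have hd2p : d2 p = o' := by rw [(h2 p hpp).2, hd1p]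
  have hod : o ≠ d2 p := by rw [hd2p]; exact hne
  refine ⟨Groves.exchange H2 p o p'' o, d2, hv2.exchange hod hpo2, ?_, ?_⟩
  · rw [hv2.lower_exchange ((hN2 p).2 rfl) hod hpo2 h2z, hd2p, h2d, heq1, heq2]
  · exact (movesTo_of_lower_eq h hv2 (heq1.trans heq2)).trans (movesTo_upper_leaf hN2 hpo2)

theorem LowerValid.lift_leaf (h : LowerValid H d) {o o' o'' : Vertex m} (ho : ¬ Boundary o)
    (hleaf : ∀ x, (lower H d).Adj o x ↔ x = o') (hoo : (lattice m).Adj o o'') :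
    ∃ H' d', LowerValid H' d' ∧ lower H' d' = swap (lower H d) s(o, o') s(o, o'') ∧
      MovesTo H H' := by
  have hadj := (hleaf o').2 rfl
  have hadj' := hadj
  obtain ⟨hne, p, hpo, hpo', -⟩ := hadj
  replace hpo := h.inc hpo
  replace hpo' := h.inc hpo'
  obtain ⟨p'', hpo2, hpo2'⟩ := exists_inc_of_lattice_adj hoo
  by_cases hpp : p = p''
  · subst hpp
    -- The old and the new neighbour belong to the same `p`; the leaf edge is first parked at a
    -- vertex `s` reached through another corner `q`.
    obtain ⟨q, hqp, hqo⟩ := exists_inc_ne o p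
    obtain ⟨s, hso, hqs⟩ := hqo.exists_ne ho
    obtain ⟨H1, d1, hv1, heq1, hm1⟩ := h.lift_leaf_of_ne ho hleaf hpo hpo' hqo hqs hso hqp.symm
    have hso' : s ≠ o' := by
      rintro rfl
      exact hso.symm (Inc.linear hpo hqo hpo' hqs hqp.symm)
    have hleaf1 : ∀ x, (lower H1 d1).Adj o x ↔ x = s := by
      intro x
      rw [heq1, swap_adj, hleaf]
      constructor
      · tauto
      · rintro rfl
        exact ⟨hso.symm, by tauto⟩
    obtain ⟨H2, d2, hv2, heq2, hm2⟩ := hv1.lift_leaf_of_ne ho hleaf1 hqo hqs hpo2 hpo2' hoo.ne.symm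
      hqp
    refine ⟨H2, d2, hv2, ?_, hm1.trans hm2⟩
    rw [heq2, heq1, swap_swap_right hso.symm]
    right
    rw [mem_edgeSet, hleaf]
    exact hso'
  · exact h.lift_leaf_of_ne ho hleaf hpo hpo' hpo2 hpo2' hoo.ne.symm hpp

/-- The hexagon is `p, x, q, y, r, z` with only the incidence of `r` and `v` missing. Replacing the
lower edge `xz` by `yz` means giving up the incidence at `p` of whichever of `x`, `z` is not the
centre and adding that of `r` and `v`. -/
theorem LowerValid.lift_hexagon (h : LowerValid H d) {x y z u v : Vertex m}
    {p q r : Vertex (m + 2)} (hpq : p ≠ q) (hpr : p ≠ r) (hqr : q ≠ r) (hxy : x ≠ y) (hxz : x ≠ z)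
    (hyz : y ≠ z) (hpx : H p x) (hpz : H p z) (hqx : H q x) (hqy : H q y) (hry : Inc r y)
    (hrz : Inc r z) (huv : (u = y ∧ v = z) ∨ (u = z ∧ v = y)) (hdr : d r = u) (hv : ¬ H r v)
    (hdp : x = d p ∨ z = d p) :
    ∃ H' d', LowerValid H' d' ∧ lower H' d' = swap (lower H d) s(x, z) s(y, z) ∧
      MovesTo H H' := by
  have hru : H r u := hdr ▸ h.center hry
  have hincv : Inc r v := by rcases huv with ⟨rfl, rfl⟩ | ⟨rfl, rfl⟩ <;> assumption
  have hvu : s(v, u) = s(y, z) := by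
    rcases huv with ⟨rfl, rfl⟩ | ⟨rfl, rfl⟩
    · exact Sym2.eq_swap
    · rfl
  have hexx : MovesTo H (Groves.exchange H p x r v) := by
    refine movesTo_hexagon (q := q) (r := r) (op := z) (oq := y) hpq hpr hqr hxz hxy hyz.symm hpx hqx
      hv ?_ hincv
    rcases huv with ⟨rfl, rfl⟩ | ⟨rfl, rfl⟩
    · exact .inl ⟨.inr rfl, rfl, .inl hpz, .inr rfl, hqy, hru⟩
    · exact .inr ⟨.inr rfl, rfl, hpz, hru, .inl hqy, .inr rfl⟩
  rcases hdp with hdp | hdp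
  · have hzd : z ≠ d p := by rw [← hdp]; exact hxz.symm
    refine ⟨Groves.exchange H p z r v, d, h.exchange hzd hincv, ?_, ?_⟩
    · rw [h.lower_exchange hpz hzd hincv hv, hdr, ← hdp, hvu, Sym2.eq_swap (a := z)]
    · rcases huv with ⟨rfl, rfl⟩ | ⟨rfl, rfl⟩
      -- Here `(p, z)` has to be exchanged for `(r, z)`, with the same small vertex on both sides,
      -- which is not a single hexagon exchange. It is composed from `(p, x)` to `(r, z)`, followed
      -- by `(p, z)` to `(p, x)`.
      · refine hexx.trans ?_
        have h2 := movesTo_hexagon (H := Groves.exchange H p x r v) (p := p) (q := r) (r := q)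
          (p' := p) (o := v) (op := x) (oq := u) (o' := x) hpr hpq hqr.symm hxz.symm hyz.symm hxy
          (.inl ⟨hpz, by tauto⟩) (.inr ⟨rfl, rfl⟩) (by simp [Groves.exchange, hpr])
          (.inl ⟨.inl rfl, rfl, .inr rfl, .inl (.inl ⟨hqx, by tauto⟩), .inl ⟨hru, by tauto⟩,
            .inl ⟨hqy, by tauto⟩⟩) (h.inc hpx)
        convert h2 using 1
        funext a b
        simp only [Groves.exchange]
        apply propext
        by_cases hap : a = p
        · subst hap
          by_cases hbx : b = x
          · subst hbx; tauto
          · tauto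
        · tauto
      · refine movesTo_hexagon (q := r) (r := q) (op := x) (oq := v) hpr hpq hqr.symm hxz.symm
          hyz.symm hxy hpz hru hv ?_ hincv
        exact .inr ⟨.inl rfl, rfl, hpx, hqx, .inr rfl, .inl hqy⟩
  · have hxd : x ≠ d p := by rw [← hdp]; exact hxz
    refine ⟨Groves.exchange H p x r v, d, h.exchange hxd hincv, ?_, hexx⟩
    rw [h.lower_exchange hpx hxd hincv hv, hdr, ← hdp, hvu]

/-- Moves of the smaller grove lift to moves of the larger one. -/
theorem LowerValid.lift (h : LowerValid H d) (hac : (lower H d).IsAcyclic)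
    {G : SimpleGraph (Vertex m)} (hG : Move (lower H d) G) :
    ∃ H' d', LowerValid H' d' ∧ lower H' d' = G ∧ MovesTo H H' := by
  cases hG with
  | leaf o o' o'' ho hleaf hoo => exact h.lift_leaf ho hleaf hoo
  | triangle x y z hxy hxz hyz =>
    obtain ⟨r, hry, hrz⟩ := exists_inc_of_lattice_adj hyz
    -- If `r` is already related to both `y` and `z`, acyclicity forces `x` to be the centre at `r`;
    -- recentring at `y` performs the move without changing `H`. Otherwise the edges `xy` and `xz`
    -- come from different points `q` and `p`, and the hexagon applies.
    by_cases hr : H r y ∧ H r z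
    · obtain ⟨hHy, hHz⟩ := hr
      have hc := h.center hry
      have hyc : y ≠ d r := by
        intro hy
        exact not_triangle hac hxy ((h.adj_iff hry hrz hyz.ne).2 ⟨hHy, hHz, .inl hy⟩) hxz
      have hzc : z ≠ d r := by
        intro hz
        exact not_triangle hac hxy ((h.adj_iff hry hrz hyz.ne).2 ⟨hHy, hHz, .inr hz⟩) hxz
      have hyd := (h.adj_iff hry (h.inc hc) hyc).2 ⟨hHy, hc, .inr rfl⟩
      have hzd := (h.adj_iff hrz (h.inc hc) hzc).2 ⟨hHz, hc, .inr rfl⟩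
      have hxd : x = d r := by
        by_contra hxd
        exact not_square hac hxy hyd hzd.symm hxz hyz.ne hxd
      subst hxd
      refine ⟨H, Function.update d r y, ⟨h.inc, fun {q o} hq => ?_⟩, ?_, MovesTo.refl H⟩
      · by_cases hqr : q = r
        · subst hqr; simpa using hHy
        · simpa [hqr] using h.center hq
      · exact star_update h.linear hHy hHz hc hyc hyz.ne.symm hzc fun w hw =>
          Inc.three' (h.inc hc) hry hrz (h.inc hw) hyc.symm hzc.symm hyz.ne
    · obtain ⟨H1, d1, u, v, huv, hv1, heq, hdu, hnv⟩ : ∃ H1 d1 u v,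
          ((u = y ∧ v = z) ∨ (u = z ∧ v = y)) ∧ LowerValid H1 d1 ∧ lower H d = lower H1 d1 ∧
            d1 r = u ∧ ¬ H1 r v := by
        by_cases hHz : H r z
        · obtain ⟨H1, d1, hv1, heq, -, h2, h3, -⟩ :=
            h.normalize hrz hry hyz.ne.symm (fun hHy => hr ⟨hHy, hHz⟩)
          exact ⟨H1, d1, z, y, .inr ⟨rfl, rfl⟩, hv1, heq, h2, h3⟩
        · obtain ⟨H1, d1, hv1, heq, -, h2, h3, -⟩ := h.normalize hry hrz hyz.ne hHz
          exact ⟨H1, d1, y, z, .inl ⟨rfl, rfl⟩, hv1, heq, h2, h3⟩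
      have hm := movesTo_of_lower_eq h hv1 heq
      rw [heq] at hxy hxz ⊢
      obtain ⟨hxy', q, hqx, hqy, -⟩ := hxy
      obtain ⟨hxz', p, hpx, hpz, hdp⟩ := hxz
      replace hqx : H1 q x := hqx
      replace hqy : H1 q y := hqy
      replace hpx : H1 p x := hpx
      replace hpz : H1 p z := hpz
      have hnot : ¬ (H1 r y ∧ H1 r z) := by
        rcases huv with ⟨rfl, rfl⟩ | ⟨rfl, rfl⟩ <;> tauto
      have hqr : q ≠ r := by
        rintro rfl
        have : p = q := by
          by_contra hpq
          exact hxz' (Inc.linear (hv1.inc hpx) (hv1.inc hqx) (hv1.inc hpz) hrz hpq)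
        subst this
        exact hnot ⟨hqy, hpz⟩
      have hpr : p ≠ r := by
        rintro rfl
        have : p = q := by
          by_contra hpq
          exact hxy' (Inc.linear (hv1.inc hpx) (hv1.inc hqx) hry (hv1.inc hqy) hpq)
        exact hqr this.symm
      have hpq : p ≠ q := by
        rintro rfl
        exact hyz.ne (Inc.linear (hv1.inc hqy) hry (hv1.inc hpz) hrz hpr)
      obtain ⟨H2, d2, hv2, heq2, hm2⟩ := hv1.lift_hexagon hpq hpr hqr hxy' hxz' hyz.ne hpx hpz hqx
        hqy hry hrz huv hdu hnv hdp
      exact ⟨H2, d2, hv2, heq2, hm.trans hm2⟩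

end Lower

/-! ### From a grove of size `m + 2` to a grove of size `m`. -/

section Descent

variable {m : ℕ}

theorem Inc.boundary {b : Vertex (m + 2)} {o : Vertex m} (h : Inc b o) (hb : Boundary b) :
    Boundary o := by
  have := b.bounds
  have := o.bounds
  unfold Boundary at *
  unfold Inc at h
  push_cast at *
  omega

/-- Labels move away from zero by 2. This map on labels is injective, so it carries the block
structure of one size to that of the other. -/
theorem Inc.label_eq {b : Vertex (m + 2)} {o : Vertex m} (h : Inc b o) (hb : Boundary b) :
    label b = if label o < 0 then label o - 2 else label o + 2 := by
  have := b.bounds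
  have := o.bounds
  unfold Boundary at hb
  unfold Inc at h
  unfold label
  push_cast at *
  rcases hb with hb | hb | hb <;> split_ifs <;> omega

theorem Boundary.exists_inc {o : Vertex m} (ho : Boundary o) :
    ∃ b : Vertex (m + 2), Boundary b ∧ Inc b o := by
  have h1 := o.bounds
  unfold Boundary at *
  unfold Inc
  rcases ho with ho | ho | ho
  · obtain ⟨b, hx, hy⟩ := exists_vertex (n := m + 2) (x := o.1.1) (y := o.1.2) (by omega)
      (by omega) (by omega) (by push_cast; omega)
    exact ⟨b, by omega, by omega⟩
  · obtain ⟨b, hx, hy⟩ := exists_vertex (n := m + 2) (x := o.1.1 - 1) (y := o.1.2 - 1) (by omega)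
      (by omega) (by omega) (by push_cast; omega)
    exact ⟨b, by push_cast; omega, by omega⟩
  · obtain ⟨b, hx, hy⟩ := exists_vertex (n := m + 2) (x := o.1.1 + 1) (y := o.1.2 - 1) (by omega)
      (by omega) (by omega) (by push_cast; omega)
    exact ⟨b, by push_cast; omega, by omega⟩

theorem exists_inc_or_label_ne {p q : Vertex (m + 2)} (h : (lattice (m + 2)).Adj p q) :
    (∃ o, Inc p o ∧ Inc q o) ∨ (Boundary p ∧ Boundary q ∧ label p ≠ label q) := by
  by_contra! hno
  obtain ⟨h1, h2⟩ := hno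
  rw [lattice_adj_iff] at h
  have hp := p.bounds
  have hq := q.bounds
  push_cast at hp hq
  -- The absence of a common apex, restated for arbitrary coordinates, so that candidate apices can
  -- be tested arithmetically. It forces both endpoints onto the same side of the triangle.
  have key : ∀ x y : ℤ, ((p.1.2 = y ∧ p.1.1 = x) ∨ (p.1.2 = y - 1 ∧ (p.1.1 = x - 1 ∨ p.1.1 = x + 1))) →
      ((q.1.2 = y ∧ q.1.1 = x) ∨ (q.1.2 = y - 1 ∧ (q.1.1 = x - 1 ∨ q.1.1 = x + 1))) →
      ¬ (y ≤ 0 ∧ x - y ≤ m ∧ -x - y ≤ m ∧ (x + y - m) % 2 = 0) := by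
    rintro x y hpx hqx ⟨h3, h4, h5, h6⟩
    obtain ⟨o, rfl, rfl⟩ := exists_vertex h3 h4 h5 h6
    exact h1 o hpx hqx
  have hb : (p.1.2 = 0 ∧ q.1.2 = 0) ∨ (p.1.1 + p.1.2 = -(m + 2) ∧ q.1.1 + q.1.2 = -(m + 2)) ∨
      (p.1.1 - p.1.2 = m + 2 ∧ q.1.1 - q.1.2 = m + 2) := by
    rcases h with ⟨h, h' | h'⟩ | ⟨h, h' | h'⟩ | ⟨h, h' | h'⟩
    · have := key q.1.1 q.1.2; omega
    · have := key q.1.1 q.1.2; omega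
    · have := key (p.1.1 - 1) (p.1.2 + 1); omega
    · have := key (p.1.1 + 1) (p.1.2 + 1); omega
    · have := key p.1.1 p.1.2; omega
    · have := key p.1.1 p.1.2; omega
  have h3 := h2 (by unfold Boundary; push_cast; omega) (by unfold Boundary; push_cast; omega)
  unfold label at h3
  clear h1 h2 key
  push_cast at *
  rcases hb with hb | hb | hb <;> split_ifs at h3 <;> omega

/-- A boundary vertex incident with some `o` is not a corner, so its block has another member; the
witnesses are found along the target paths. -/
theorem Inc.exists_boundary_ne {b : Vertex (m + 2)} {o : Vertex m} (h : Inc b o)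
    (hb : Boundary b) : ∃ b', Boundary b' ∧ b' ≠ b ∧ label b' = label b := by
  have h1 := b.bounds
  have h2 := o.bounds
  suffices ∃ b' : Vertex (m + 2), Boundary b' ∧ ¬ (b'.1.1 = b.1.1 ∧ b'.1.2 = b.1.2) ∧
      label b' = label b by
    obtain ⟨b', h1, h2, h3⟩ := this
    exact ⟨b', h1, by rintro rfl; simp at h2, h3⟩
  unfold Boundary at *
  unfold Inc at h
  push_cast at *
  by_cases h0 : b.1.2 = 0
  · by_cases hx : 0 < b.1.1
    · obtain ⟨b', hx', hy'⟩ := exists_vertex (n := m + 2) (x := (b.1.1 + m + 2) / 2)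
        (y := (b.1.1 - m - 2) / 2) (by omega) (by push_cast; omega) (by push_cast; omega)
        (by push_cast; omega)
      exact ⟨b', by omega, by omega, by unfold label; push_cast; split_ifs <;> omega⟩
    · obtain ⟨b', hx', hy'⟩ := exists_vertex (n := m + 2) (x := (b.1.1 - m - 2) / 2)
        (y := (-b.1.1 - m - 2) / 2) (by omega) (by push_cast; omega) (by push_cast; omega)
        (by push_cast; omega)
      exact ⟨b', by omega, by omega, by unfold label; push_cast; split_ifs <;> omega⟩
  · by_cases hy : (m + 2 : ℤ) < -2 * b.1.2
    · obtain ⟨b', hx', hy'⟩ := exists_vertex (n := m + 2) (x := -b.1.1)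
        (y := b.1.2) (by omega) (by push_cast; omega) (by push_cast; omega)
        (by push_cast; omega)
      exact ⟨b', by omega, by omega, by unfold label; push_cast; split_ifs <;> omega⟩
    · by_cases hx : b.1.1 < 0
      · obtain ⟨b', hx', hy'⟩ := exists_vertex (n := m + 2) (x := -m - 2 - 2 * b.1.2)
          (y := 0) (by omega) (by push_cast; omega) (by push_cast; omega)
          (by push_cast; omega)
        exact ⟨b', by omega, by omega, by unfold label; push_cast; split_ifs <;> omega⟩
      · obtain ⟨b', hx', hy'⟩ := exists_vertex (n := m + 2) (x := m + 2 + 2 * b.1.2)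
          (y := 0) (by omega) (by push_cast; omega) (by push_cast; omega)
          (by push_cast; omega)
        exact ⟨b', by omega, by omega, by unfold label; push_cast; split_ifs <;> omega⟩

variable {G : SimpleGraph (Vertex (m + 2))}

theorem IsGrove.exists_inc (hG : IsGrove (m + 2) G) {p q : Vertex (m + 2)} (h : G.Adj p q) :
    ∃ o, Inc p o ∧ Inc q o := by
  rcases exists_inc_or_label_ne (hG.le_lattice h) with h' | ⟨hp, hq, hne⟩
  · exact h'
  · exact absurd (((isGrove_iff.1 hG).2.2.2 p q hp hq).1 h.reachable) hne

/-- An acyclic graph on three vertices has at most one nontrivial component, which is a star; `N` is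
that component, or a single corner if there are no edges. -/
theorem exists_local_star (hG : G.IsAcyclic) (o : Vertex m) :
    ∃ (N : Vertex (m + 2) → Prop) (c : Vertex (m + 2)), N c ∧ (∀ x, N x → Inc x o) ∧
      ∀ u v, Inc u o → Inc v o → u ≠ v → (G.Adj u v ↔ N u ∧ N v ∧ (u = c ∨ v = c)) := by
  obtain ⟨p, q, r, hpq, hpr, hqr, h⟩ := exists_inc_triple o
  simp only [h]
  have key : ∀ (N : Vertex (m + 2) → Prop) (c : Vertex (m + 2)),
      (G.Adj p q ↔ N p ∧ N q ∧ (p = c ∨ q = c)) → (G.Adj p r ↔ N p ∧ N r ∧ (p = c ∨ r = c)) →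
      (G.Adj q r ↔ N q ∧ N r ∧ (q = c ∨ r = c)) →
      ∀ u v, (u = p ∨ u = q ∨ u = r) → (v = p ∨ v = q ∨ v = r) → u ≠ v →
        (G.Adj u v ↔ N u ∧ N v ∧ (u = c ∨ v = c)) := by
    intro N c h1 h2 h3 u v hu hv huv
    have hsymm : ∀ {a b}, (G.Adj a b ↔ N a ∧ N b ∧ (a = c ∨ b = c)) →
        (G.Adj b a ↔ N b ∧ N a ∧ (b = c ∨ a = c)) := by
      intro a b hab
      rw [adj_comm, hab]
      exact ⟨fun h => ⟨h.2.1, h.1, h.2.2.symm⟩, fun h => ⟨h.2.1, h.1, h.2.2.symm⟩⟩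
    rcases hu with rfl | rfl | rfl <;> rcases hv with rfl | rfl | rfl
    · exact absurd rfl huv
    · exact h1
    · exact h2
    · exact hsymm h1
    · exact absurd rfl huv
    · exact h3
    · exact hsymm h2
    · exact hsymm h3
    · exact absurd rfl huv
  have htri : ¬ (G.Adj p q ∧ G.Adj q r ∧ G.Adj p r) := fun h => not_triangle hG h.1 h.2.1 h.2.2
  by_cases h1 : G.Adj p q <;> by_cases h2 : G.Adj p r <;> by_cases h3 : G.Adj q r
  · exact absurd ⟨h1, h3, h2⟩ htri
  · refine ⟨fun x => x = p ∨ x = q ∨ x = r, p, by simp, fun x h => h, key _ _ ?_ ?_ ?_⟩ <;>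
      simp [h1, h2, h3, hpq.symm, hpr.symm]
  · refine ⟨fun x => x = p ∨ x = q ∨ x = r, q, by simp, fun x h => h, key _ _ ?_ ?_ ?_⟩ <;>
      simp [h1, h2, h3, hpq, hqr.symm]
  · refine ⟨fun x => x = p ∨ x = q, p, .inl rfl, fun x h => h.elim .inl fun h => .inr (.inl h), key _ _ ?_ ?_ ?_⟩ <;>
      simp [h1, h2, h3, hpr.symm, hqr.symm]
  · refine ⟨fun x => x = p ∨ x = q ∨ x = r, r, by simp, fun x h => h, key _ _ ?_ ?_ ?_⟩ <;>
      simp [h1, h2, h3, hpr, hqr]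
  · refine ⟨fun x => x = p ∨ x = r, p, .inl rfl, fun x h => h.elim .inl fun h => .inr (.inr h), key _ _ ?_ ?_ ?_⟩ <;>
      simp [h1, h2, h3, hpq.symm, hqr]
  · refine ⟨fun x => x = q ∨ x = r, q, .inl rfl, fun x h => .inr h, key _ _ ?_ ?_ ?_⟩ <;>
      simp [h1, h2, h3, hpq, hpr]
  · refine ⟨fun x => x = p, p, rfl, fun x h => .inl h, key _ _ ?_ ?_ ?_⟩ <;>
      simp [h1, h2, h3, hpq.symm, hpr.symm]

theorem IsGrove.exists_valid (hG : IsGrove (m + 2) G) :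
    ∃ H c, Valid H c ∧ star H c = G := by
  choose N c hc hN hadj using fun o : Vertex m => exists_local_star hG.acyclic o
  refine ⟨fun p o => N o p, c, ⟨fun {p o} h => hN o p h, hc⟩, ?_⟩
  ext u v
  rw [star_adj]
  constructor
  · rintro ⟨hne, o, h1, h2, h3⟩
    exact (hadj o u v (hN _ _ h1) (hN _ _ h2) hne).2 ⟨h1, h2, h3⟩
  · intro h
    obtain ⟨o, h1, h2⟩ := hG.exists_inc h
    exact ⟨h.ne, o, (hadj o u v h1 h2 h.ne).1 h⟩

theorem star_reachable {P O : Type*} {H : P → O → Prop} {c : O → P} {p q : P} {o : O}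
    (hc : H (c o) o) (hp : H p o) (hq : H q o) : (star H c).Reachable p q := by
  have key : ∀ x, H x o → (star H c).Reachable x (c o) := by
    intro x hx
    by_cases h : x = c o
    · rw [h]
    · exact (star_adj.2 ⟨h, o, hx, hc, .inr rfl⟩ : (star H c).Adj x (c o)).reachable
  exact (key p hp).trans (key q hq).symm

/-- Connectivity of either star graph is that of the bipartite graph `H`, so it passes from one side
to the other. -/
theorem star_reachable_flip {P O : Type*} {H : P → O → Prop} {c : O → P} {d : P → O}
    (hd : ∀ p o, H p o → H p (d p)) {p q : P} {o o' : O} (ho : H p o) (ho' : H q o')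
    (h : (star H c).Reachable p q) : (star (flip H) d).Reachable o o' := by
  refine of_reachable (φ := fun q => ∀ o', H q o' → (star (flip H) d).Reachable o o') ?_ h ?_ o' ho'
  · rintro u v hu ⟨-, b, hub, hvb, -⟩ o' hv
    exact (hu b hub).trans (star_reachable (H := flip H) (hd v b hvb) hvb hv)
  · intro o' hp
    exact star_reachable (H := flip H) (hd p o ho) ho hp

/-- A lower cycle through the edge from `d p` to `b` would yield a cycle of `H`, and hence one of
the upper graph. -/
theorem not_reachable_lower {H : Vertex (m + 2) → Vertex m → Prop} {c : Vertex m → Vertex (m + 2)}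
    {d : Vertex (m + 2) → Vertex m} (hv : Valid H c) (hac : (star H c).IsAcyclic)
    {p : Vertex (m + 2)} {b : Vertex m} (hpd : H p (d p)) (hpb : H p b) (hbd : b ≠ d p) :
    ¬ ((lower H d).deleteEdges {s(d p, b)}).Reachable (d p) b := by
  -- The upper graph with the star of `b` removed. A walk in it from `p` to another point of `b`
  -- would close a cycle through that star.
  set K := star (fun p o => H p o ∧ o ≠ b) c with hK
  have hKne : ∀ x, x ≠ p → H x b → ¬ K.Reachable p x := by
    intro x hxp hxb hr
    obtain ⟨t, hpt, htx, htb⟩ : ∃ t, (star H c).Adj p t ∧ (t = x ∨ (star H c).Adj x t) ∧ H t b := by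
      by_cases hpc : p = c b
      · exact ⟨x, star_adj.2 ⟨hxp.symm, b, hpb, hxb, .inl hpc⟩, .inl rfl, hxb⟩
      · refine ⟨c b, star_adj.2 ⟨hpc, b, hpb, hv.center b, .inr rfl⟩, ?_, hv.center b⟩
        by_cases hxc : c b = x
        · exact .inl hxc
        · exact .inr (star_adj.2 ⟨Ne.symm hxc, b, hxb, hv.center b, .inr rfl⟩)
    refine not_reachable_deleteEdges hac hpt ?_
    refine (Reachable.mono ?_ hr).trans ?_
    · intro u v huv
      obtain ⟨hne, o, ⟨h1, hob⟩, ⟨h2, -⟩, h3⟩ := huv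
      rw [deleteEdges_pair_adj]
      refine ⟨⟨hne, o, h1, h2, h3⟩, ?_⟩
      rintro (⟨rfl, rfl⟩ | ⟨rfl, rfl⟩)
      · exact hob (hv.linear hne h1 h2 hpb htb)
      · exact hob (hv.linear hne h1 h2 htb hpb)
    · rcases htx with rfl | htx
      · exact .refl _
      · refine Adj.reachable (deleteEdges_pair_adj.2 ⟨htx, ?_⟩)
        rintro (⟨h, -⟩ | ⟨-, h⟩)
        · exact hxp h
        · exact hpt.ne h.symm
  intro hr
  -- The invariant: the walk avoids `b` and stays at vertices related to the `K`-component of `p`.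
  -- It could enter `b` only through `p` itself, that is, along the deleted edge.
  have := of_reachable (φ := fun o => o ≠ b ∧ ∃ x, K.Reachable p x ∧ H x o) ?_ hr
    ⟨hbd.symm, p, .refl _, hpd⟩
  · exact this.1 rfl
  · rintro u v ⟨hub, x, hpx, hxu⟩ huv
    rw [deleteEdges_pair_adj, lower_adj] at huv
    obtain ⟨⟨huv, q, hqu, hqv, hd⟩, hne⟩ := huv
    have hpq : K.Reachable p q := hpx.trans
      (star_reachable (H := fun p o => H p o ∧ o ≠ b) ⟨hv.center u, hub⟩ ⟨hxu, hub⟩ ⟨hqu, hub⟩)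
    refine ⟨?_, q, hpq, hqv⟩
    rintro rfl
    by_cases hqp : q = p
    · subst hqp
      exact hne (.inl ⟨hd.resolve_right hbd, rfl⟩)
    · exact hKne q hqp hqv hpq

theorem IsGrove.exists_lower (hG : IsGrove (m + 2) G) :
    ∃ H c d, Valid H c ∧ star H c = G ∧ LowerValid H d ∧ IsGrove m (lower H d) := by
  obtain ⟨H, c, hv, rfl⟩ := hG.exists_valid
  have hG' := isGrove_iff.1 hG
  -- Every incident `p` is related to something because it has an edge: an interior vertex must
  -- reach the boundary, and a boundary vertex must reach the rest of its block.
  have hne : ∀ p, ∃ o', ∀ o, Inc p o → H p o' := by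
    intro p
    by_cases hp : ∃ o, Inc p o
    · obtain ⟨o, ho⟩ := hp
      obtain ⟨q, -, o', hpo, -, -⟩ : ∃ q, (star H c).Adj p q := by
        by_cases hb : Boundary p
        · obtain ⟨b, hb', hbp, hlab⟩ := ho.exists_boundary_ne hb
          exact exists_adj_of_reachable ((hG'.2.2.2 _ _ hb hb').2 hlab.symm) hbp.symm
        · exact hG.exists_adj hb
      exact ⟨o', fun _ _ => hpo⟩
    · push Not at hp
      obtain ⟨o⟩ : Nonempty (Vertex m) :=
        let ⟨o, _, _⟩ := exists_vertex (n := m) (x := -m) (y := 0) (by omega) (by omega) (by omega)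
          (by omega)
        ⟨o⟩
      exact ⟨o, fun o' h => absurd h (hp o')⟩
  choose d hd using hne
  have hlv : LowerValid H d := ⟨hv.inc, fun {p o} h => hd p o h⟩
  have hreach : ∀ {p q o o'}, H p o → H q o' →
      ((star H c).Reachable p q ↔ (lower H d).Reachable o o') := by
    intro p q o o' hp hq
    exact ⟨star_reachable_flip (fun p o h => hd p o (hv.inc h)) hp hq,
      star_reachable_flip (H := flip H) (fun o p _ => hv.center o) hp hq⟩
  have hmem : ∀ {b o}, Boundary b → Inc b o → H b o := by
    intro b o hb hbo
    have h1 := hd b o hbo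
    by_cases h : o = d b
    · rw [h]; exact h1
    · exact absurd hb (Inc.not_boundary hbo (hv.inc h1) h)
  refine ⟨H, c, d, hv, rfl, hlv, isGrove_iff.2 ⟨?_, ?_, ?_, ?_⟩⟩
  · rintro u v ⟨hne, p, hu, hv', -⟩
    exact Inc.lattice_adj' (hv.inc hu) (hv.inc hv') hne
  · refine isAcyclic_of_forall ?_
    rintro u v ⟨hne, p, hu, hv', rfl | rfl⟩
    · exact not_reachable_lower hv hG.acyclic hu hv' hne.symm
    · rw [Sym2.eq_swap, reachable_comm]
      exact not_reachable_lower hv hG.acyclic hv' hu hne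
  · intro o
    obtain ⟨b, hb, hcb⟩ := hG'.2.2.1 (c o)
    have hco := hv.center o
    have hinc : ∃ o', Inc b o' := by
      by_cases h : b = c o
      · exact ⟨o, h ▸ hv.inc hco⟩
      · obtain ⟨q, hq⟩ := exists_adj_of_reachable hcb.symm h
        obtain ⟨o', ho', -⟩ := hG.exists_inc hq
        exact ⟨o', ho'⟩
    obtain ⟨o', ho'⟩ := hinc
    exact ⟨o', ho'.boundary hb, (hreach hco (hmem hb ho')).1 hcb⟩
  · intro o o' ho ho'
    obtain ⟨b, hb, hbo⟩ := ho.exists_inc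
    obtain ⟨b', hb', hbo'⟩ := ho'.exists_inc
    rw [← hreach (hmem hb hbo) (hmem hb' hbo'), hG'.2.2.2 b b' hb hb', hbo.label_eq hb,
      hbo'.label_eq hb']
    split_ifs <;> omega

end Descent

/-! ### Connectedness of groves under moves, by induction on the size. -/

theorem moves_of_isGrove (n : ℕ) : ∀ G G' : SimpleGraph (Vertex n), IsGrove n G → IsGrove n G' →
    Relation.ReflTransGen Move G G' := by
  -- For these sizes every vertex is on the boundary and the labels are distinct, so a grove has no
  -- edges.
  have hbase : ∀ n : ℕ, n ≤ 1 → ∀ G : SimpleGraph (Vertex n), IsGrove n G → G = ⊥ := by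
    intro n hn G hG
    ext u v
    simp only [bot_adj, iff_false]
    intro h
    have hu := u.bounds
    have hv := v.bounds
    have hlab := ((isGrove_iff.1 hG).2.2.2 u v (by unfold Boundary; omega)
      (by unfold Boundary; omega)).1 h.reachable
    refine h.ne (vertex_ext ?_ ?_) <;> unfold label at hlab <;> split_ifs at hlab <;> omega
  induction n using Nat.strong_induction_on with
  | _ n ih =>
    intro G G' hG hG'
    rcases Nat.lt_or_ge 1 n with hn | hn
    · obtain ⟨m, rfl⟩ : ∃ m, n = m + 2 := ⟨n - 2, by omega⟩
      obtain ⟨H, c, d, hv, rfl, hlv, hl⟩ := hG.exists_lower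
      obtain ⟨H', c', d', hv', rfl, hlv', hl'⟩ := hG'.exists_lower
      have key : ∀ K, Relation.ReflTransGen Move (lower H d) K →
          ∃ H1 d1, LowerValid H1 d1 ∧ lower H1 d1 = K ∧ MovesTo H H1 := by
        intro K hK
        induction hK with
        | refl => exact ⟨H, d, hlv, rfl, MovesTo.refl H⟩
        | tail hK h ih =>
          obtain ⟨H1, d1, hlv1, rfl, hm⟩ := ih
          obtain ⟨H2, d2, hlv2, rfl, hm2⟩ := hlv1.lift (hl.moves hK).acyclic h
          exact ⟨H2, d2, hlv2, rfl, hm.trans hm2⟩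
      obtain ⟨H1, d1, hlv1, heq, hm⟩ := key _ (ih m (by omega) _ _ hl hl')
      obtain ⟨c2, hv2, hmoves⟩ := (hm.trans (movesTo_of_lower_eq hlv1 hlv' heq)) c hv hG
      exact hmoves.trans (moves_recenter hv2 hv')
    · rw [hbase n hn G hG, hbase n hn G' hG']

/-! ### The target graph is a grove. -/

section Target

variable {n : ℕ}

/-- Both kinds of path steps lower `x + 3y` by 2. The label names the path part and `x + 3y` is the
position on it, so edges join consecutive positions with equal label. -/
theorem target_adj {u v : Vertex n} : (target n).Adj u v ↔ label u = label v ∧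
    (u.1.1 + 3 * u.1.2 = v.1.1 + 3 * v.1.2 + 2 ∨ v.1.1 + 3 * v.1.2 = u.1.1 + 3 * u.1.2 + 2) := by
  have hu := u.bounds
  have hv := v.bounds
  have key : ∀ u v : Vertex n, (∃ k : ℤ,
      (u.1.1 + u.1.2 = -n + 2 * k ∧ v.1 = u.1 + (1, -1) ∧ -k ≤ v.1.2) ∨
      (u.1.2 = -k ∧ v.1 = u.1 + (2, 0) ∧ v.1.1 ≤ -n + 3 * k)) ↔
      (v.1.1 = u.1.1 + 1 ∧ v.1.2 = u.1.2 - 1 ∧ -2 * v.1.2 ≤ u.1.1 + u.1.2 + n) ∨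
      (v.1.2 = u.1.2 ∧ v.1.1 = u.1.1 + 2 ∧ v.1.1 ≤ -n - 3 * u.1.2) := by
    intro u v
    have hu := u.bounds
    simp only [Prod.ext_iff, Prod.fst_add, Prod.snd_add]
    constructor
    · rintro ⟨k, h⟩
      omega
    · rintro (h | h)
      · exact ⟨(u.1.1 + u.1.2 + n) / 2, by omega⟩
      · exact ⟨-u.1.2, by omega⟩
  rw [target, fromRel_adj, key, key]
  constructor
  · rintro ⟨-, (h | h) | (h | h)⟩ <;> unfold label <;> split_ifs <;> omega
  · rintro ⟨h, h'⟩
    refine ⟨by rintro rfl; omega, ?_⟩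
    unfold label at h
    rcases h' with h' | h' <;> split_ifs at h <;> omega

theorem eq_of_label_eq {u v : Vertex n} (h : label u = label v)
    (h' : u.1.1 + 3 * u.1.2 = v.1.1 + 3 * v.1.2) : u = v := by
  have hu := u.bounds
  have hv := v.bounds
  unfold label at h
  split_ifs at h <;> apply vertex_ext <;> omega

/-- One step back along the path: east in the row part, north-west from the bend onwards. The
presence of `u` further up keeps this step inside the triangle. -/
theorem exists_next {u v : Vertex n} (h : label u = label v)
    (h' : v.1.1 + 3 * v.1.2 < u.1.1 + 3 * u.1.2) : ∃ w : Vertex n, label w = label v ∧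
      w.1.1 + 3 * w.1.2 = v.1.1 + 3 * v.1.2 + 2 := by
  have hu := u.bounds
  have hv := v.bounds
  by_cases hk : v.1.1 + v.1.2 + n < -2 * v.1.2
  · obtain ⟨w, hx, hy⟩ := exists_vertex (n := n) (x := v.1.1 + 2) (y := v.1.2) (by omega)
      (by unfold label at h; split_ifs at h <;> omega) (by omega) (by omega)
    have hw := w.bounds
    exact ⟨w, by unfold label; split_ifs <;> omega, by omega⟩
  · obtain ⟨w, hx, hy⟩ := exists_vertex (n := n) (x := v.1.1 - 1) (y := v.1.2 + 1)
      (by unfold label at h; split_ifs at h <;> omega) (by omega) (by omega) (by omega)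
    have hw := w.bounds
    exact ⟨w, by unfold label; split_ifs <;> omega, by omega⟩

theorem target_reachable {u v : Vertex n} (h : label u = label v) : (target n).Reachable u v := by
  have key : ∀ (k : ℕ) (u v : Vertex n), label u = label v →
      u.1.1 + 3 * u.1.2 - (v.1.1 + 3 * v.1.2) = k → (target n).Reachable u v := by
    intro k
    induction k using Nat.strong_induction_on with
    | _ k ih =>
      intro u v h hk
      by_cases h0 : k = 0
      · rw [eq_of_label_eq h (by omega)]
      · obtain ⟨w, hw, hwp⟩ := exists_next h (by omega)
        have hu := u.bounds
        have hv := v.bounds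
        refine (ih (k - 2) (by omega) u w (h.trans hw.symm) (by omega)).trans ?_
        exact (target_adj.2 ⟨hw, .inl hwp⟩).reachable
  rcases le_total (v.1.1 + 3 * v.1.2) (u.1.1 + 3 * u.1.2) with h' | h'
  · exact key _ u v h (Int.toNat_of_nonneg (by omega)).symm
  · exact (key _ v u h.symm (Int.toNat_of_nonneg (by omega)).symm).symm

theorem label_eq_of_reachable {u v : Vertex n} (h : (target n).Reachable u v) :
    label u = label v :=
  of_reachable (φ := fun w => label u = label w)
    (fun _ _ h1 h2 => h1.trans (target_adj.1 h2).1) h rfl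

theorem exists_boundary_label_eq (v : Vertex n) : ∃ b : Vertex n, Boundary b ∧ label v = label b := by
  have hv := v.bounds
  by_cases h1 : 0 < v.1.1 + v.1.2 ∨ (-2 * v.1.2 ≤ n ∧ -2 * v.1.2 ≤ v.1.1 + v.1.2 + n)
  -- On the diagonal part the path is followed to its top end; on the row part, in the other case,
  -- to its west end.
  · obtain ⟨b, hx, hy⟩ := exists_vertex (n := n) (x := v.1.1 + v.1.2) (y := 0) (by omega) (by omega)
      (by omega) (by omega)
    exact ⟨b, by unfold Boundary; omega, by unfold label; split_ifs <;> omega⟩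
  · obtain ⟨b, hx, hy⟩ := exists_vertex (n := n) (x := -n - v.1.2) (y := v.1.2) (by omega) (by omega)
      (by omega) (by omega)
    exact ⟨b, by unfold Boundary; omega, by unfold label; split_ifs <;> omega⟩

theorem isGrove_target (n : ℕ) : IsGrove n (target n) := by
  refine isGrove_iff.2 ⟨fun u v h => ?_, isAcyclic_of_forall fun u v h hr => ?_, fun v => ?_,
    fun b b' _ _ => ⟨label_eq_of_reachable, target_reachable⟩⟩
  · obtain ⟨h, h'⟩ := target_adj.1 h
    have hu := u.bounds
    have hv := v.bounds
    rw [lattice_adj_iff]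
    unfold label at h
    rcases h' with h' | h' <;> split_ifs at h <;> omega
  · rcases (target_adj.1 h).2 with h' | h'
    -- Once `uv` is deleted, the positions on the path at or above that of `u` are closed under
    -- adjacency, so `v` is cut off. The other orientation is symmetric.
    · have := of_reachable (φ := fun w => label u = label w ∧
        u.1.1 + 3 * u.1.2 ≤ w.1.1 + 3 * w.1.2) ?_ hr ⟨rfl, le_rfl⟩
      · omega
      · rintro w x ⟨hw, hw'⟩ hwx
        rw [deleteEdges_pair_adj, target_adj] at hwx
        obtain ⟨⟨hl, hp⟩, hne⟩ := hwx
        refine ⟨hw.trans hl, ?_⟩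
        by_contra! hlt
        have hux : w.1.1 + 3 * w.1.2 ≠ u.1.1 + 3 * u.1.2 := fun e =>
          hne (.inl ⟨eq_of_label_eq hw.symm e, eq_of_label_eq
            (hl.symm.trans (hw.symm.trans (target_adj.1 h).1)) (by omega)⟩)
        have hxv : x.1.1 + 3 * x.1.2 ≠ v.1.1 + 3 * v.1.2 := by omega
        have h1 := w.bounds
        have h2 := u.bounds
        have h3 := x.bounds
        omega
    · have := of_reachable (φ := fun w => label u = label w ∧
        w.1.1 + 3 * w.1.2 ≤ u.1.1 + 3 * u.1.2) ?_ hr ⟨rfl, le_rfl⟩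
      · omega
      · rintro w x ⟨hw, hw'⟩ hwx
        rw [deleteEdges_pair_adj, target_adj] at hwx
        obtain ⟨⟨hl, hp⟩, hne⟩ := hwx
        refine ⟨hw.trans hl, ?_⟩
        by_contra! hlt
        have hux : w.1.1 + 3 * w.1.2 ≠ u.1.1 + 3 * u.1.2 := fun e =>
          hne (.inl ⟨eq_of_label_eq hw.symm e, eq_of_label_eq
            (hl.symm.trans (hw.symm.trans (target_adj.1 h).1)) (by omega)⟩)
        have h1 := w.bounds
        have h2 := u.bounds
        have h3 := x.bounds
        omega
  · obtain ⟨b, hb, h⟩ := exists_boundary_label_eq v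
    exact ⟨b, hb, target_reachable h⟩

end Target

end Groves

theorem theorem4 (n : ℕ) :
    Groves.IsGrove n (Groves.target n) ∧
      ∀ G : SimpleGraph (Groves.Vertex n), Groves.IsGrove n G →
        Relation.ReflTransGen (Groves.GroveStep n) G (Groves.target n) := by
  have hT := Groves.isGrove_target n
  exact ⟨hT, fun G hG => Groves.groveStep_of_moves hG (Groves.moves_of_isGrove n G _ hG hT)⟩
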